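/- Let $N\ge 3$. Work in a coordinate chart $U\subset\mathbb R^N$ with a $C^\infty$ Riemannian metric $a_{mn}(x)$, $S(x,t)=\sqrt{a_{mn}(x)t^mt^n}$, Christoffel symbols $a^i{}_{kn}$, and curvature tensor $$a_n{}^i{}_{km}=\frac{\partial a^i{}_{nm}}{\partial x^k}-\frac{\partial a^i{}_{nk}}{\partial x^m}+a^u{}_{nm}a^i{}_{uk}-a^u{}_{nk}a^i{}_{um}.$$ Let $F(x,y)>0$ be a $C^\infty$ Finsler metric function, positively homogeneous of degree 1 in $y$, on an open set $D$ of pairs $(x,y)$, $x\in U$, $y\neq0$, that is conic in $y$. Put $y_i=\frac12\partial F^2/\partial y^i$, $g_{ij}=\partial y_i/\partial y^j$ (nondegenerate, with inverse $g^{ij}$), $l^i=y^i/F$, $l_i=y_i/F$, $C_{mnk}=\frac12\partial g_{mn}/\partial y^k$, $C^n{}_{hk}=g^{nm}C_{mhk}$. Assume that the Finsler space is conformally automorphic to the Riemannian one with constant degree $H>0$: there is a smooth fibrewise transformation $t=t(x,y)$ of $D$ onto an open set $D'$, with smooth inverse $y=y(x,t)$, such that $t(x,ky)=k^Ht(x,y)$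 for $k>0$; such that $g_{mn}(x,y)=c(x,y)\,a_{ij}(x)\,t^i_mt^j_n$ with some positive factor $c$; and such that $F(x,y)=1$ if and only if $S(x,t(x,y))=1$. Here $t^i_m=\partial t^i/\partial y^m$, $t^h_{km}=\partial t^h_k/\partial y^m$, $y^n_m=\partial y^n/\partial t^m$ (taken at $t=t(x,y)$). Put $p=\frac1HF^{1-H}$. Define $$N^m{}_n=-y^m_i\Bigl(\frac{\partial t^i}{\partial x^n}+a^i{}_{kn}t^k\Bigr),\qquad D^n{}_{ij}=-\frac{\partial N^n{}_i}{\partial y^j},\qquad d_i=\frac{\partial}{\partial x^i}+N^k{}_i\frac{\partial}{\partial y^k},$$ $$M^n{}_{ij}=d_iN^n{}_j-d_jN^n{}_i,\qquad E_k{}^n{}_{ij}=d_iD^n{}_{jk}-d_jD^n{}_{ik}+D^m{}_{jk}D^n{}_{im}-D^m{}_{ik}D^n{}_{jm},$$ $$\rho_k{}^n{}_{ij}=E_k{}^n{}_{ij}-M^h{}_{ij}C^n{}_{hk}.$$ Write $\rho_{knij}=g_{mn}\rho_k{}^m{}_{ij}$, $M_{nij}=g_{nm}M^m{}_{ij}$,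 $a_{hlij}=a_{lr}a_h{}^r{}_{ij}$. The last two indices $i,j$ of $\rho$, $M$ and $a$, and the first index of $a$, are raised with $a^{mn}$; the first index of $\rho$ is raised with $g^{mn}$: $\rho^{knij}=g^{qk}a^{mi}a^{rj}\rho_q{}^n{}_{mr}$, $M^{nij}=a^{hi}a^{rj}M^n{}_{hr}$, $a_l{}^{nij}=a^{mi}a^{rj}a_l{}^n{}_{mr}$, $a^{hnij}=a^{hl}a_l{}^{nij}$. The covariant derivatives are $$\mathcal D_kM^n{}_{ij}=d_kM^n{}_{ij}+D^n{}_{kt}M^t{}_{ij}-a^s{}_{ki}M^n{}_{sj}-a^s{}_{kj}M^n{}_{is},$$ $$\mathcal D_l\rho_k{}^n{}_{ij}=d_l\rho_k{}^n{}_{ij}+D^n{}_{lt}\rho_k{}^t{}_{ij}-D^t{}_{lk}\rho_t{}^n{}_{ij}-a^s{}_{li}\rho_k{}^n{}_{sj}-a^s{}_{lj}\rho_k{}^n{}_{is}.$$ Then, at every point $(x,y)\in D$ and for all values of the free indices, with $t=t(x,y)$ and $S=S(x,t)$: 1. $M^n{}_{ij}=-y^n_t\,t^h\,a_h{}^t{}_{ij}$;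 2. $E_k{}^n{}_{ij}=y^n_h\,t^h_{km}M^m{}_{ij}+y^n_m\,a_h{}^m{}_{ij}\,t^h_k$; 3. $\rho_{knij}=-(1-H)\frac1F(l_kM_{nij}-l_nM_{kij})+p^2a_{hlij}t^h_kt^l_n$; 4. $\rho_k{}^n{}_{ij}=-(1-H)\frac1F(l_k\delta^n_m-l^ng_{mk})M^m{}_{ij}+y^n_m\,a_h{}^m{}_{ij}\,t^h_k$; 5. $\rho^{knij}=-(1-H)\frac1F(l^kM^{nij}-l^nM^{kij})+\frac1{p^2}y^k_hy^n_ra^{hrij}$; 6. $M_{nij}=-p^2t^ht^m_na_{hmij}$; 7. $M^{nij}M_{nij}=p^2\,t^la_l{}^{nij}\,t^ha_{hnij}$; 8. $\rho_{mnij}=-\rho_{nmij}$; 9. $\mathcal D_kM^n{}_{ij}+\mathcal D_jM^n{}_{ki}+\mathcal D_iM^n{}_{jk}=0$; 10. $\mathcal D_l\rho_k{}^n{}_{ij}+\mathcal D_j\rho_k{}^n{}_{li}+\mathcal D_i\rho_k{}^n{}_{jl}=0$; 11. $\rho^{knij}\rho_{knij}=a^{knij}a_{knij}+\frac2{S^2}\left(\frac1{H^2}-1\right)t^la_l{}^{nij}\,t^ha_{hnij}$.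 -/

import Mathlib

open scoped BigOperators ContDiff

/-- Local coordinates: points `x` of a chart, or components of tangent vectors. -/
abbrev Coord (N : ℕ) := Fin N → ℝ

namespace FinslerAngle

variable {N : ℕ}

/-! ### Partial derivatives -/

/-- `∂f/∂x^i` of a function of one point. -/
noncomputable def pd (f : Coord N → ℝ) (i : Fin N) (x : Coord N) : ℝ :=
  fderiv ℝ f x (Pi.single i 1)

/-- `∂f/∂x^i` of a function `f(x, y)`, with `y` fixed. -/
noncomputable def pdX (f : Coord N → Coord N → ℝ) (i : Fin N) (x y : Coord N) : ℝ :=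
  pd (fun x' => f x' y) i x

/-- `∂f/∂y^i` of a function `f(x, y)`, with `x` fixed. -/
noncomputable def pdY (f : Coord N → Coord N → ℝ) (i : Fin N) (x y : Coord N) : ℝ :=
  pd (fun y' => f x y') i y

/-! ### Finsler metric tensor of a metric function `F(x, y)` -/

/-- `y_i = (1/2) ∂F²/∂y^i`. -/
noncomputable def covector (F : Coord N → Coord N → ℝ) (i : Fin N) (x y : Coord N) : ℝ :=
  (1 / 2) * pdY (fun x y => F x y ^ 2) i x y

/-- `g_{ij} = ∂y_i/∂y^j = (1/2) ∂²F²/∂y^i∂y^j`, as a matrix. -/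
noncomputable def metric (F : Coord N → Coord N → ℝ) (x y : Coord N) :
    Matrix (Fin N) (Fin N) ℝ :=
  Matrix.of fun i j => pdY (covector F i) j x y

/-! ### Riemannian objects of a metric tensor `a_{mn}(x)` -/

/-- `S(x, t) = √(a_{mn}(x) t^m t^n)`. -/
noncomputable def riemNorm (a : Coord N → Matrix (Fin N) (Fin N) ℝ) (x t : Coord N) : ℝ :=
  Real.sqrt (∑ m, ∑ n, a x m n * t m * t n)

/-- Christoffel symbols
`a^i_{kn} = (1/2) a^{ih} (∂a_{hk}/∂x^n + ∂a_{hn}/∂x^k - ∂a_{kn}/∂x^h)`. -/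
noncomputable def christoffel (a : Coord N → Matrix (Fin N) (Fin N) ℝ)
    (i k n : Fin N) (x : Coord N) : ℝ :=
  (1 / 2) * ∑ h, (a x)⁻¹ i h *
    (pd (fun x => a x h k) n x + pd (fun x => a x h n) k x - pd (fun x => a x k n) h x)

/-- Riemannian curvature tensor `a_n^i_{km}
= ∂a^i_{nm}/∂x^k - ∂a^i_{nk}/∂x^m + a^u_{nm} a^i_{uk} - a^u_{nk} a^i_{um}`. -/
noncomputable def riemCurv (a : Coord N → Matrix (Fin N) (Fin N) ℝ)
    (n i k m : Fin N) (x : Coord N) : ℝ :=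
  pd (christoffel a i n m) k x - pd (christoffel a i n k) m x
    + ∑ u, (christoffel a u n m x * christoffel a i u k x
      - christoffel a u n k x * christoffel a i u m x)

/-- `a_{hlij} = a_{lr} a_h^r_{ij}`. -/
noncomputable def riemCurvLow (a : Coord N → Matrix (Fin N) (Fin N) ℝ)
    (h l i j : Fin N) (x : Coord N) : ℝ :=
  ∑ r, a x l r * riemCurv a h r i j x

/-- `a_h^{nij} = a^{mi} a^{rj} a_h^n_{mr}`. -/
noncomputable def riemCurvMid (a : Coord N → Matrix (Fin N) (Fin N) ℝ)
    (h n i j : Fin N) (x : Coord N) : ℝ :=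
  ∑ m, ∑ r, (a x)⁻¹ m i * (a x)⁻¹ r j * riemCurv a h n m r x

/-- `a^{hrij} = a^{hl} a_l^{rij} = a^{hl} a^{mi} a^{nj} a_l^r_{mn}`. -/
noncomputable def riemCurvUp (a : Coord N → Matrix (Fin N) (Fin N) ℝ)
    (h r i j : Fin N) (x : Coord N) : ℝ :=
  ∑ l, (a x)⁻¹ h l * riemCurvMid a l r i j x

end FinslerAngle

open FinslerAngle

/-- A Finsler space which is conformally automorphic, with constant degree `H`, to a Riemannian
space, in a coordinate chart `U ⊆ ℝ^N` and over an open conic domain `D` of nonzero tangent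
vectors. The transformation is `t = t(x, y)`, with inverse `y = y(x, t)`. -/
structure ConformallyAutomorphicSpace (N : ℕ) where
  /-- the chart domain -/
  U : Set (Coord N)
  isOpen_U : IsOpen U
  /-- the Riemannian metric tensor `a_{mn}(x)` -/
  a : Coord N → Matrix (Fin N) (Fin N) ℝ
  smooth_a : ∀ m n, ContDiffOn ℝ ∞ (fun x => a x m n) U
  posDef_a : ∀ x ∈ U, (a x).PosDef
  /-- the domain of tangent vectors `(x, y)` of the Finsler space -/
  D : Set (Coord N × Coord N)
  isOpen_D : IsOpen D
  mem_U_of_mem_D : ∀ x y, (x, y) ∈ D → x ∈ U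
  ne_zero_of_mem_D : ∀ x y, (x, y) ∈ D → y ≠ 0
  smul_mem_D : ∀ x y, (x, y) ∈ D → ∀ k : ℝ, 0 < k → (x, k • y) ∈ D
  /-- the Finsler metric function -/
  F : Coord N → Coord N → ℝ
  smooth_F : ContDiffOn ℝ ∞ (fun z : Coord N × Coord N => F z.1 z.2) D
  F_pos : ∀ x y, (x, y) ∈ D → 0 < F x y
  F_homog : ∀ x y, (x, y) ∈ D → ∀ k : ℝ, 0 < k → F x (k • y) = k * F x y
  metric_nondegenerate : ∀ x y, (x, y) ∈ D → (metric F x y).det ≠ 0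
  /-- the domain of the transformed vectors `(x, t)` -/
  D' : Set (Coord N × Coord N)
  isOpen_D' : IsOpen D'
  /-- the transformation `y ↦ t` in each tangent space -/
  t : Coord N → Coord N → Coord N
  /-- the inverse transformation `t ↦ y` in each tangent space -/
  yInv : Coord N → Coord N → Coord N
  smooth_t : ContDiffOn ℝ ∞ (fun z : Coord N × Coord N => t z.1 z.2) D
  smooth_yInv : ContDiffOn ℝ ∞ (fun z : Coord N × Coord N => yInv z.1 z.2) D'
  t_mem : ∀ x y, (x, y) ∈ D → (x, t x y) ∈ D'
  yInv_mem : ∀ x τ, (x, τ) ∈ D' → (x, yInv x τ) ∈ D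
  left_inv : ∀ x y, (x, y) ∈ D → yInv x (t x y) = y
  right_inv : ∀ x τ, (x, τ) ∈ D' → t x (yInv x τ) = τ
  /-- the degree of conformal automorphism, a constant -/
  H : ℝ
  H_pos : 0 < H
  t_homog : ∀ x y, (x, y) ∈ D → ∀ k : ℝ, 0 < k → t x (k • y) = k ^ H • t x y
  /-- in each tangent space the Finsler metric tensor is conformal to the pull-back of the
  Riemannian one -/
  conformal : ∃ c : Coord N → Coord N → ℝ, ∀ x y, (x, y) ∈ D → 0 < c x y ∧
    ∀ m n, metric F x y m n = c x y * ∑ i, ∑ j, a x i j *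
      pdY (fun x y => t x y i) m x y * pdY (fun x y => t x y j) n x y
  /-- the indicatrix corresponds to the Riemannian unit sphere -/
  indicatrix : ∀ x y, (x, y) ∈ D → (F x y = 1 ↔ riemNorm a x (t x y) = 1)

namespace ConformallyAutomorphicSpace

variable {N : ℕ} (A : ConformallyAutomorphicSpace N)

/-! ### Algebraic objects -/

/-- `p = F^{1-H} / H`. -/
noncomputable def p (x y : Coord N) : ℝ := (1 / A.H) * A.F x y ^ (1 - A.H)

/-- `g_{ij}`. -/
noncomputable def g (i j : Fin N) (x y : Coord N) : ℝ := metric A.F x y i j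

/-- `g^{ij}`, the reciprocal tensor. -/
noncomputable def gUp (i j : Fin N) (x y : Coord N) : ℝ := (metric A.F x y)⁻¹ i j

/-- `a^{ij}`, the reciprocal tensor. -/
noncomputable def aUp (i j : Fin N) (x : Coord N) : ℝ := (A.a x)⁻¹ i j

/-- `l_k = y_k / F`. -/
noncomputable def lLow (k : Fin N) (x y : Coord N) : ℝ := covector A.F k x y / A.F x y

/-- `l^k = y^k / F`. -/
noncomputable def lUp (k : Fin N) (x y : Coord N) : ℝ := y k / A.F x y

/-- Cartan tensor `C_{mnk} = (1/2) ∂g_{mn}/∂y^k`. -/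
noncomputable def C (m n k : Fin N) (x y : Coord N) : ℝ := (1 / 2) * pdY (A.g m n) k x y

/-- `C^n_{hk} = g^{nm} C_{mhk}`. -/
noncomputable def CUp (n h k : Fin N) (x y : Coord N) : ℝ :=
  ∑ m, A.gUp n m x y * A.C m h k x y

/-- `t^m_k = ∂t^m/∂y^k`. -/
noncomputable def tD (m k : Fin N) (x y : Coord N) : ℝ := pdY (fun x y => A.t x y m) k x y

/-- `t^h_{km} = ∂t^h_k/∂y^m`. -/
noncomputable def tDD (h k m : Fin N) (x y : Coord N) : ℝ := pdY (A.tD h k) m x y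

/-- `y^n_m = ∂y^n/∂t^m`, taken at `t = t(x, y)`. -/
noncomputable def yD (n m : Fin N) (x y : Coord N) : ℝ :=
  pdY (fun x τ => A.yInv x τ n) m x (A.t x y)

/-! ### The connection -/

/-- `N^m_n = -y^m_i (∂t^i/∂x^n + a^i_{kn} t^k)`. -/
noncomputable def Nc (m n : Fin N) (x y : Coord N) : ℝ :=
  -∑ i, A.yD m i x y *
    (pdX (fun x y => A.t x y i) n x y + ∑ k, christoffel A.a i k n x * A.t x y k)

/-- `D^n_{ij} = -∂N^n_i/∂y^j`. -/
noncomputable def Dc (n i j : Fin N) (x y : Coord N) : ℝ := -pdY (A.Nc n i) j x y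

/-- The operator `d_i = ∂/∂x^i + N^k_i ∂/∂y^k`. -/
noncomputable def d (i : Fin N) (f : Coord N → Coord N → ℝ) (x y : Coord N) : ℝ :=
  pdX f i x y + ∑ k, A.Nc k i x y * pdY f k x y

/-! ### Curvature objects -/

/-- `M^n_{ij} = d_i N^n_j - d_j N^n_i`. -/
noncomputable def M (n i j : Fin N) (x y : Coord N) : ℝ :=
  A.d i (A.Nc n j) x y - A.d j (A.Nc n i) x y

/-- `E_k^n_{ij} = d_i D^n_{jk} - d_j D^n_{ik} + D^m_{jk} D^n_{im} - D^m_{ik} D^n_{jm}`. -/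
noncomputable def E (k n i j : Fin N) (x y : Coord N) : ℝ :=
  A.d i (A.Dc n j k) x y - A.d j (A.Dc n i k) x y
    + ∑ m, (A.Dc m j k x y * A.Dc n i m x y - A.Dc m i k x y * A.Dc n j m x y)

/-- The curvature tensor `ρ_k^n_{ij} = E_k^n_{ij} - M^h_{ij} C^n_{hk}`. -/
noncomputable def rho (k n i j : Fin N) (x y : Coord N) : ℝ :=
  A.E k n i j x y - ∑ h, A.M h i j x y * A.CUp n h k x y

/-- `ρ_{knij} = g_{mn} ρ_k^m_{ij}`. -/
noncomputable def rhoLow (k n i j : Fin N) (x y : Coord N) : ℝ :=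
  ∑ m, A.g m n x y * A.rho k m i j x y

/-- `ρ^{knij} = g^{pk} a^{mi} a^{rj} ρ_p^n_{mr}`. -/
noncomputable def rhoUp (k n i j : Fin N) (x y : Coord N) : ℝ :=
  ∑ q, ∑ m, ∑ r, A.gUp q k x y * A.aUp m i x * A.aUp r j x * A.rho q n m r x y

/-- `M_{nij} = g_{nm} M^m_{ij}`. -/
noncomputable def MLow (n i j : Fin N) (x y : Coord N) : ℝ :=
  ∑ m, A.g n m x y * A.M m i j x y

/-- `M^{mij} = a^{hi} a^{nj} M^m_{hn}`. -/
noncomputable def MUp (m i j : Fin N) (x y : Coord N) : ℝ :=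
  ∑ h, ∑ n, A.aUp h i x * A.aUp n j x * A.M m h n x y

/-- The covariant derivative `𝒟_k M^n_{ij}
= d_k M^n_{ij} + D^n_{kt} M^t_{ij} - a^s_{ki} M^n_{sj} - a^s_{kj} M^n_{is}`. -/
noncomputable def covM (k n i j : Fin N) (x y : Coord N) : ℝ :=
  A.d k (A.M n i j) x y + ∑ s, A.Dc n k s x y * A.M s i j x y
    - ∑ s, christoffel A.a s k i x * A.M n s j x y
    - ∑ s, christoffel A.a s k j x * A.M n i s x y

/-- The covariant derivative `𝒟_l ρ_k^n_{ij} = d_l ρ_k^n_{ij} + D^n_{lt} ρ_k^t_{ij}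
- D^t_{lk} ρ_t^n_{ij} - a^s_{li} ρ_k^n_{sj} - a^s_{lj} ρ_k^n_{is}`. -/
noncomputable def covRho (l k n i j : Fin N) (x y : Coord N) : ℝ :=
  A.d l (A.rho k n i j) x y + ∑ s, A.Dc n l s x y * A.rho k s i j x y
    - ∑ s, A.Dc s l k x y * A.rho s n i j x y
    - ∑ s, christoffel A.a s l i x * A.rho k n s j x y
    - ∑ s, christoffel A.a s l j x * A.rho k n i s x y

/-- The scalar `t^l a_l^{nij} t^h a_{hnij}`. -/
noncomputable def Q (x y : Coord N) : ℝ :=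
  ∑ l, ∑ h, ∑ n, ∑ i, ∑ j, A.t x y l * riemCurvMid A.a l n i j x *
    (A.t x y h * riemCurvLow A.a h n i j x)

end ConformallyAutomorphicSpace

/-! Write T for the matrix of t^i_m, Γ_l and D_l for the matrices of the two connections, R_ij for
the Riemannian curvature. The coefficients N are made so that d_l t = -Γ_l t (`dR_comp_tR`). A
further y-derivative gives d_l T = -Γ_l T + T D_l (`TR_map_dR`): T intertwines the Finsler
connection with the Riemannian one. The commutator of d_i and d_j is the vertical field M_ij;
applied to t it yields T M_ij = -R_ij t (`TR_mulVec_MR`), and the y-derivative of this identity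
yields E (`TR_mul_ER`).

Homogeneity and the indicatrix condition give S = F^H, and contracting the conformal relation twice
with y then forces c = p² (`metric_eq`). Differentiating g = p² Tᵀ a T and solving for ∂T, as one
solves for Christoffel symbols, expresses T⁻¹∂T through the Cartan tensor and terms with the factor
(1-H)/F² (`TR_inv_mul_V_TR`). The Cartan part cancels in ρ, so that ρ_ij = T⁻¹ · `curvMap` R_ij · T
(`rhoR_eq_curvMap`), where `curvMap` B = B + μ (Bt ⊗ t♭ - t ⊗ (Bt)♭) and μ = (1-H)/(H S²).

The rest is linear algebra on R_ij. Since t and a are parallel and S is constant along d_l,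
`curvMap` commutes with covariant differentiation; it also preserves skewness. So both properties of
R pass to ρ. On a skew B it keeps the components orthogonal to t and multiplies those along t by
1/H, which explains the factor 1/H² - 1 in the norm identity (`trace_curvMap_mul`).

All calculus is done in the commutative ring of smooth functions on D, where ∂/∂x^i and ∂/∂y^i are
commuting derivations; `Rep` ties its elements to the functions defined in coordinates. -/

/-! ### The ring of smooth functions on an open set, and its directional derivatives -/

section SmoothFun

variable {W : Type*} [NormedAddCommGroup W] [NormedSpace ℝ W]

/-- The algebra of smooth real functions on an open set of a normed space. -/
def smoothFun (Ω : TopologicalSpace.Opens W) : Subalgebra ℝ (Ω → ℝ) where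
  carrier := {φ | ∃ f : W → ℝ, ContDiffOn ℝ ∞ f Ω ∧ ∀ z : Ω, φ z = f z}
  mul_mem' := by
    rintro _ _ ⟨f, hf, hf'⟩ ⟨g, hg, hg'⟩
    exact ⟨fun z => f z * g z, hf.mul hg, fun z => by simp [hf', hg']⟩
  add_mem' := by
    rintro _ _ ⟨f, hf, hf'⟩ ⟨g, hg, hg'⟩
    exact ⟨fun z => f z + g z, hf.add hg, fun z => by simp [hf', hg']⟩
  algebraMap_mem' r := ⟨fun _ => r, contDiffOn_const, fun _ => rfl⟩

variable {Ω : TopologicalSpace.Opens W}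

namespace smoothFun

/-- Evaluation at a point. -/
def ev (z : Ω) : smoothFun Ω →ₐ[ℝ] ℝ := (Pi.evalAlgHom ℝ (fun _ : Ω => ℝ) z).comp (smoothFun Ω).val

theorem ext_ev {φ ψ : smoothFun Ω} (h : ∀ z, ev z φ = ev z ψ) : φ = ψ :=
  Subtype.ext (funext h)

/-- The function `f` agrees on `Ω` with the smooth function `φ`. -/
def Rep (f : W → ℝ) (φ : smoothFun Ω) : Prop := ∀ z : Ω, f z = ev z φ

theorem exists_rep (φ : smoothFun Ω) : ∃ f : W → ℝ, ContDiffOn ℝ ∞ f Ω ∧ Rep f φ := by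
  obtain ⟨f, hf, h⟩ := φ.2
  exact ⟨f, hf, fun z => (h z).symm⟩

theorem exists_rep_of_contDiffOn {f : W → ℝ} (hf : ContDiffOn ℝ ∞ f Ω) :
    ∃ φ : smoothFun Ω, Rep f φ :=
  ⟨⟨fun z => f z, f, hf, fun _ => rfl⟩, fun _ => rfl⟩

theorem Rep.contDiffOn {f : W → ℝ} {φ : smoothFun Ω} (h : Rep f φ) : ContDiffOn ℝ ∞ f Ω := by
  obtain ⟨g, hg, hg'⟩ := exists_rep φ
  exact hg.congr fun z hz => (h ⟨z, hz⟩).trans (hg' ⟨z, hz⟩).symm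

theorem Rep.differentiableAt {f : W → ℝ} {φ : smoothFun Ω} (h : Rep f φ) (z : Ω) :
    DifferentiableAt ℝ f z :=
  (h.contDiffOn.contDiffAt (Ω.isOpen.mem_nhds z.2)).differentiableAt (by simp)

/-- As Ω is open, the derivative at its points does not see the values outside. This makes `dir`
independent of the chosen representative. -/
theorem Rep.fderiv_eq {f g : W → ℝ} {φ : smoothFun Ω} (hf : Rep f φ) (hg : Rep g φ) (z : Ω) :
    fderiv ℝ f z = fderiv ℝ g z := by
  apply Filter.EventuallyEq.fderiv_eq
  filter_upwards [Ω.isOpen.mem_nhds z.2] with w hw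
  exact (hf ⟨w, hw⟩).trans (hg ⟨w, hw⟩).symm

/-- The representing function of a smooth function on `Ω`. -/
noncomputable def rep (φ : smoothFun Ω) : W → ℝ := (exists_rep φ).choose

theorem rep_rep (φ : smoothFun Ω) : Rep (rep φ) φ := (exists_rep φ).choose_spec.2

theorem rep_eq (φ : smoothFun Ω) (z : Ω) : rep φ z = ev z φ := rep_rep φ z

theorem Rep.add {f g : W → ℝ} {φ ψ : smoothFun Ω} (hf : Rep f φ) (hg : Rep g ψ) :
    Rep (fun z => f z + g z) (φ + ψ) := fun z => by simp [hf z, hg z]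

theorem Rep.mul {f g : W → ℝ} {φ ψ : smoothFun Ω} (hf : Rep f φ) (hg : Rep g ψ) :
    Rep (fun z => f z * g z) (φ * ψ) := fun z => by simp [hf z, hg z]

/-- The derivative in the direction `v`. -/
noncomputable def dir (v : W) : Derivation ℝ (smoothFun Ω) (smoothFun Ω) :=
  Derivation.mk'
    { toFun := fun φ => ⟨fun z => fderiv ℝ (rep φ) z v, fun z => fderiv ℝ (rep φ) z v,
        ((rep_rep φ).contDiffOn.fderiv_of_isOpen Ω.isOpen (m := ∞) (by simp)).clm_apply
          contDiffOn_const, fun _ => rfl⟩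
      map_add' := fun φ ψ => by
        apply ext_ev
        intro z
        change fderiv ℝ (rep (φ + ψ)) z v = fderiv ℝ (rep φ) z v + fderiv ℝ (rep ψ) z v
        rw [(rep_rep (φ + ψ)).fderiv_eq ((rep_rep φ).add (rep_rep ψ)),
          fderiv_fun_add ((rep_rep φ).differentiableAt z) ((rep_rep ψ).differentiableAt z)]
        rfl
      map_smul' := fun r φ => by
        apply ext_ev
        intro z
        change fderiv ℝ (rep (r • φ)) z v = r * fderiv ℝ (rep φ) z v
        have h : Rep (fun z => r * rep φ z) (r • φ) := fun z => by simp [rep_eq]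
        rw [(rep_rep (r • φ)).fderiv_eq h,
          fderiv_const_mul ((rep_rep φ).differentiableAt z)]
        rfl }
    fun φ ψ => by
      apply ext_ev
      intro z
      have e : ev z (φ • (⟨fun z => fderiv ℝ (rep ψ) z v, fun z => fderiv ℝ (rep ψ) z v,
        ((rep_rep ψ).contDiffOn.fderiv_of_isOpen Ω.isOpen (m := ∞) (by simp)).clm_apply
          contDiffOn_const, fun _ => rfl⟩ : smoothFun Ω) +
          ψ • (⟨fun z => fderiv ℝ (rep φ) z v, fun z => fderiv ℝ (rep φ) z v,
        ((rep_rep φ).contDiffOn.fderiv_of_isOpen Ω.isOpen (m := ∞) (by simp)).clm_apply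
          contDiffOn_const, fun _ => rfl⟩ : smoothFun Ω)) =
          ev z φ * fderiv ℝ (rep ψ) z v + ev z ψ * fderiv ℝ (rep φ) z v := rfl
      refine Eq.trans ?_ e.symm
      change fderiv ℝ (rep (φ * ψ)) z v = _
      rw [(rep_rep (φ * ψ)).fderiv_eq ((rep_rep φ).mul (rep_rep ψ)),
        fderiv_fun_mul ((rep_rep φ).differentiableAt z) ((rep_rep ψ).differentiableAt z)]
      simp [rep_eq]

theorem Rep.fderiv {f : W → ℝ} {φ : smoothFun Ω} (h : Rep f φ) (v : W) :
    Rep (fun z => fderiv ℝ f z v) (dir v φ) := fun z => by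
  change _root_.fderiv ℝ f z v = _root_.fderiv ℝ (rep φ) z v
  rw [h.fderiv_eq (rep_rep φ)]

theorem dir_comm (v w : W) (φ : smoothFun Ω) : dir v (dir w φ) = dir w (dir v φ) := by
  apply ext_ev
  intro z
  rw [← ((rep_rep φ).fderiv w).fderiv v z, ← ((rep_rep φ).fderiv v).fderiv w z]
  have hc := (rep_rep φ).contDiffOn.contDiffAt (Ω.isOpen.mem_nhds z.2)
  have hd : DifferentiableAt ℝ (_root_.fderiv ℝ (rep φ)) z :=
    (hc.fderiv_right (m := 1) (by norm_cast)).differentiableAt (by simp)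
  -- Over ℝ, C² regularity is enough for the second derivative to be symmetric.
  have hs : IsSymmSndFDerivAt ℝ (rep φ) (z : W) := hc.isSymmSndFDerivAt (by
    simpa using (WithTop.coe_le_coe.2 le_top : ((2 : ℕ∞) : WithTop ℕ∞) ≤ ∞))
  beta_reduce
  rw [fderiv_clm_apply hd (differentiableAt_const _),
    fderiv_clm_apply hd (differentiableAt_const _)]
  simpa using hs.eq v w

theorem isUnit_of_ev_ne_zero {φ : smoothFun Ω} (h : ∀ z, ev z φ ≠ 0) : IsUnit φ := by
  obtain ⟨f, hf, hr⟩ := exists_rep φ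
  obtain ⟨ψ, hψ⟩ := exists_rep_of_contDiffOn (hf.inv fun z hz => by rw [hr ⟨z, hz⟩]; exact h _)
  refine IsUnit.of_mul_eq_one ψ (ext_ev fun z => ?_)
  rw [map_mul, ← hψ z, ← hr z, map_one]
  exact mul_inv_cancel₀ (by rw [hr z]; exact h z)

end smoothFun

end SmoothFun

/-! ### Matrices over a commutative ring with derivations -/

section MatrixDerivation

open Matrix

variable {R : Type*} [CommRing R] [Algebra ℝ R] {n : Type*}

theorem Matrix.map_derivation_vecMulVec (D : Derivation ℝ R R) (u v : n → R) :
    (vecMulVec u v).map D = vecMulVec (D ∘ u) v + vecMulVec u (D ∘ v) := by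
  ext i j
  simp [vecMulVec_apply, mul_comm, add_comm]

theorem Matrix.map_derivation_add (D : Derivation ℝ R R) (A B : Matrix n n R) :
    (A + B).map D = A.map D + B.map D := by
  ext i j; simp

theorem Matrix.map_derivation_sub (D : Derivation ℝ R R) (A B : Matrix n n R) :
    (A - B).map D = A.map D - B.map D := by
  ext i j; simp

theorem Matrix.map_derivation_smul (D : Derivation ℝ R R) (c : R) (A : Matrix n n R) :
    (c • A).map D = c • A.map D + D c • A := by
  ext i j; simp [mul_comm]

theorem Matrix.map_derivation_comm {D E : Derivation ℝ R R} (h : ∀ φ, D (E φ) = E (D φ))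
    (A : Matrix n n R) : (A.map E).map D = (A.map D).map E := by
  ext i j; simp [h]

variable [Fintype n]

theorem Matrix.map_derivation_mul (D : Derivation ℝ R R) (A B : Matrix n n R) :
    (A * B).map D = A.map D * B + A * B.map D := by
  ext i j
  simp [Matrix.mul_apply, map_sum, Finset.sum_add_distrib, mul_comm, add_comm]

theorem Matrix.comp_derivation_mulVec (D : Derivation ℝ R R) (A : Matrix n n R) (v : n → R) :
    D ∘ (A *ᵥ v) = A.map D *ᵥ v + A *ᵥ (D ∘ v) := by
  ext i
  simp [Matrix.mulVec, dotProduct, map_sum, Finset.sum_add_distrib, mul_comm, add_comm]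

variable {ι : Type*} (X : ι → Derivation ℝ R R) (G : ι → Matrix n n R)

/-- The curvature `X_i G_j - X_j G_i + [G_i, G_j]` of a connection. -/
def curvMat (i j : ι) : Matrix n n R :=
  (G j).map (X i) - (G i).map (X j) + G i * G j - G j * G i

theorem curvMat_swap (i j : ι) : curvMat X G j i = -curvMat X G i j := by
  unfold curvMat; abel

variable {X G}

/-- The second derivatives of G cancel because the derivations commute; what is left is a
noncommutative polynomial identity of Jacobi type. -/
theorem curvMat_bianchi (hX : ∀ i j φ, X i (X j φ) = X j (X i φ)) (l i j : ι) :
    ((curvMat X G i j).map (X l) + G l * curvMat X G i j - curvMat X G i j * G l)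
    + ((curvMat X G l i).map (X j) + G j * curvMat X G l i - curvMat X G l i * G j)
    + ((curvMat X G j l).map (X i) + G i * curvMat X G j l - curvMat X G j l * G i) = 0 := by
  simp only [curvMat, map_derivation_add, map_derivation_sub, map_derivation_mul]
  rw [map_derivation_comm (hX l j), map_derivation_comm (hX i j), map_derivation_comm (hX i l)]
  noncomm_ring

/-- Compute the two mixed derivatives of a parallel metric from the compatibility equation; their
equality is the claim. -/
theorem curvMat_antisymm (hX : ∀ i j φ, X i (X j φ) = X j (X i φ)) {a : Matrix n n R}
    (ha : ∀ l, a.map (X l) = (G l)ᵀ * a + a * G l) (i j : ι) :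
    (curvMat X G i j)ᵀ * a + a * curvMat X G i j = 0 := by
  have h := map_derivation_comm (hX i j) a
  rw [ha i, ha j] at h
  simp only [map_derivation_add, map_derivation_mul, ha, transpose_map] at h
  simp only [curvMat, transpose_add, transpose_sub, transpose_mul, ← transpose_map]
  rw [← sub_eq_zero] at h
  rw [← h]
  simp only [← transpose_map]
  noncomm_ring

end MatrixDerivation

/-! ### The Levi-Civita connection over a ring with derivations -/

section Christoffel

open Matrix

variable {R : Type*} [CommRing R] [Algebra ℝ R] {n : Type*} [Fintype n] [DecidableEq n]
  (X : n → Derivation ℝ R R) (a : Matrix n n R)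

/-- The Christoffel symbols of the second kind, `(i, k)` being the entry of `Γ^i_{kl}`. -/
noncomputable def christoffelMat (l : n) : Matrix n n R :=
  a⁻¹ * Matrix.of fun m k => (1 / 2 : ℝ) • (X l (a m k) + X k (a m l) - X m (a k l))

variable {X a}

theorem christoffelMat_symm (ha : aᵀ = a) (i k l : n) :
    christoffelMat X a l i k = christoffelMat X a k i l := by
  have h : ∀ i j, a j i = a i j := fun i j => congrFun (congrFun ha i) j
  simp only [christoffelMat, Matrix.mul_apply, Matrix.of_apply]
  refine Finset.sum_congr rfl fun m _ => ?_
  rw [h k l, add_comm (X l (a m k))]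

/-- Lowering the upper index of the Christoffel symbols cancels the inverse metric. In the sum with
the transpose two of the three derivative terms drop out. -/
theorem christoffelMat_compat (ha : aᵀ = a) (hu : IsUnit a.det) (l : n) :
    a.map (X l) = (christoffelMat X a l)ᵀ * a + a * christoffelMat X a l := by
  have h : ∀ i j, a j i = a i j := fun i j => congrFun (congrFun ha i) j
  have h1 : (christoffelMat X a l)ᵀ * a = (a * christoffelMat X a l)ᵀ := by
    rw [transpose_mul, ha]
  rw [h1, christoffelMat, ← Matrix.mul_assoc, mul_nonsing_inv _ hu, Matrix.one_mul]
  ext i j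
  simp only [map_apply, Matrix.add_apply, transpose_apply, of_apply]
  rw [h i j]
  module

end Christoffel

namespace ConformallyAutomorphicSpace

variable {N : ℕ} (A : ConformallyAutomorphicSpace N)

/-! ### The ring of smooth functions of `(x, y)` -/

/-- The domain `D` as an open set. -/
def opens : TopologicalSpace.Opens (Coord N × Coord N) := ⟨A.D, A.isOpen_D⟩

/-- The smooth functions on `D`. -/
def SmoothRing : Type := smoothFun A.opens

noncomputable instance : CommRing A.SmoothRing := inferInstanceAs (CommRing (smoothFun A.opens))

noncomputable instance : Algebra ℝ A.SmoothRing :=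
  inferInstanceAs (Algebra ℝ (smoothFun A.opens))

/-- Evaluation of a smooth function at a point of `D`. -/
noncomputable def ev {x y : Coord N} (h : (x, y) ∈ A.D) : A.SmoothRing →ₐ[ℝ] ℝ :=
  smoothFun.ev (Ω := A.opens) ⟨(x, y), h⟩

/-- The function `f(x, y)` agrees on `D` with the smooth function `φ`. -/
def Rep (f : Coord N → Coord N → ℝ) (φ : A.SmoothRing) : Prop :=
  ∀ x y, ∀ h : (x, y) ∈ A.D, f x y = A.ev h φ

/-- The operator `∂/∂x^i`. -/
noncomputable def X (i : Fin N) : Derivation ℝ A.SmoothRing A.SmoothRing :=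
  smoothFun.dir (Pi.single i 1, 0)

/-- The operator `∂/∂y^i`. -/
noncomputable def V (i : Fin N) : Derivation ℝ A.SmoothRing A.SmoothRing :=
  smoothFun.dir (0, Pi.single i 1)

variable {A}

theorem X_comm (i j : Fin N) (φ : A.SmoothRing) : A.X i (A.X j φ) = A.X j (A.X i φ) :=
  smoothFun.dir_comm _ _ φ

theorem V_comm (i j : Fin N) (φ : A.SmoothRing) : A.V i (A.V j φ) = A.V j (A.V i φ) :=
  smoothFun.dir_comm _ _ φ

theorem X_V_comm (i j : Fin N) (φ : A.SmoothRing) : A.X i (A.V j φ) = A.V j (A.X i φ) :=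
  smoothFun.dir_comm _ _ φ

theorem ext_ev {φ ψ : A.SmoothRing} (h : ∀ x y (h : (x, y) ∈ A.D), A.ev h φ = A.ev h ψ) :
    φ = ψ :=
  smoothFun.ext_ev fun z => h z.1.1 z.1.2 z.2

theorem isUnit_of_ev_ne_zero {φ : A.SmoothRing} (h : ∀ x y (h : (x, y) ∈ A.D), A.ev h φ ≠ 0) :
    IsUnit φ :=
  smoothFun.isUnit_of_ev_ne_zero fun z => h z.1.1 z.1.2 z.2

namespace Rep

theorem uncurry {f : Coord N → Coord N → ℝ} {φ : A.SmoothRing} (h : A.Rep f φ) :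
    smoothFun.Rep (fun z : Coord N × Coord N => f z.1 z.2) φ :=
  fun z => h z.1.1 z.1.2 z.2

theorem pdX {f : Coord N → Coord N → ℝ} {φ : A.SmoothRing} (h : A.Rep f φ) (i : Fin N) :
    A.Rep (pdX f i) (A.X i φ) := fun x y hxy => by
  refine Eq.trans ?_ (h.uncurry.fderiv (Pi.single i 1, 0) ⟨(x, y), hxy⟩)
  beta_reduce
  have hd := (h.uncurry.differentiableAt ⟨(x, y), hxy⟩).hasFDerivAt
  have := hd.comp (f := fun x' : Coord N => (x', y)) x
    ((hasFDerivAt_id x).prodMk (hasFDerivAt_const y x))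
  rw [FinslerAngle.pdX, pd, show (fun x' => f x' y) =
    (fun z : Coord N × Coord N => f z.1 z.2) ∘ fun x' => (x', y) from rfl, this.fderiv]
  rfl

theorem pdY {f : Coord N → Coord N → ℝ} {φ : A.SmoothRing} (h : A.Rep f φ) (i : Fin N) :
    A.Rep (pdY f i) (A.V i φ) := fun x y hxy => by
  refine Eq.trans ?_ (h.uncurry.fderiv (0, Pi.single i 1) ⟨(x, y), hxy⟩)
  beta_reduce
  have hd := (h.uncurry.differentiableAt ⟨(x, y), hxy⟩).hasFDerivAt
  have := hd.comp (f := fun y' : Coord N => (x, y')) y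
    ((hasFDerivAt_const x y).prodMk (hasFDerivAt_id y))
  rw [FinslerAngle.pdY, pd, show (fun y' => f x y') =
    (fun z : Coord N × Coord N => f z.1 z.2) ∘ fun y' => (x, y') from rfl, this.fderiv]
  rfl

variable {f g : Coord N → Coord N → ℝ} {φ ψ : A.SmoothRing}

theorem add (hf : A.Rep f φ) (hg : A.Rep g ψ) : A.Rep (fun x y => f x y + g x y) (φ + ψ) :=
  fun x y h => by simp only [map_add, hf x y h, hg x y h]

theorem sub (hf : A.Rep f φ) (hg : A.Rep g ψ) : A.Rep (fun x y => f x y - g x y) (φ - ψ) :=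
  fun x y h => by simp only [map_sub, hf x y h, hg x y h]

theorem mul (hf : A.Rep f φ) (hg : A.Rep g ψ) : A.Rep (fun x y => f x y * g x y) (φ * ψ) :=
  fun x y h => by simp only [map_mul, hf x y h, hg x y h]

theorem neg (hf : A.Rep f φ) : A.Rep (fun x y => -f x y) (-φ) :=
  fun x y h => by simp only [map_neg, hf x y h]

theorem const_mul (c : ℝ) (hf : A.Rep f φ) : A.Rep (fun x y => c * f x y) (c • φ) :=
  fun x y h => by simp only [map_smul, hf x y h, smul_eq_mul]

theorem sum {ι : Type*} {s : Finset ι} {f : ι → Coord N → Coord N → ℝ} {φ : ι → A.SmoothRing}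
    (h : ∀ i, A.Rep (f i) (φ i)) : A.Rep (fun x y => ∑ i ∈ s, f i x y) (∑ i ∈ s, φ i) :=
  fun x y hxy => by
    rw [map_sum]
    exact Finset.sum_congr rfl fun i _ => h i x y hxy

/-- The entries of the inverse of an everywhere invertible matrix of smooth functions. -/
theorem matrix_inv {B : Coord N → Coord N → Matrix (Fin N) (Fin N) ℝ}
    {b : Matrix (Fin N) (Fin N) A.SmoothRing} (h : ∀ i j, A.Rep (fun x y => B x y i j) (b i j))
    (hu : IsUnit b.det) (i j : Fin N) : A.Rep (fun x y => (B x y)⁻¹ i j) (b⁻¹ i j) :=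
  fun x y hxy => by
    have hb : (A.ev hxy).mapMatrix b = B x y := by
      ext i j
      exact (h i j x y hxy).symm
    have h1 : B x y * (A.ev hxy).mapMatrix b⁻¹ = 1 := by
      rw [← hb, ← map_mul, Matrix.mul_nonsing_inv _ hu, map_one]
    beta_reduce
    rw [Matrix.inv_eq_right_inv h1]
    rfl

theorem isUnit_det {B : Coord N → Coord N → Matrix (Fin N) (Fin N) ℝ}
    {b : Matrix (Fin N) (Fin N) A.SmoothRing} (h : ∀ i j, A.Rep (fun x y => B x y i j) (b i j))
    (hu : ∀ x y, (x, y) ∈ A.D → (B x y).det ≠ 0) : IsUnit b.det :=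
  isUnit_of_ev_ne_zero fun x y hxy => by
    have hb : (A.ev hxy).mapMatrix b = B x y := by
      ext i j
      exact (h i j x y hxy).symm
    rw [AlgHom.map_det, hb]
    exact hu x y hxy

end Rep

variable (A)

theorem exists_rep {f : Coord N → Coord N → ℝ}
    (hf : ContDiffOn ℝ ∞ (fun z : Coord N × Coord N => f z.1 z.2) A.D) : ∃ φ, A.Rep f φ := by
  obtain ⟨φ, h⟩ := smoothFun.exists_rep_of_contDiffOn (Ω := A.opens) hf
  exact ⟨φ, fun x y hxy => h ⟨(x, y), hxy⟩⟩

variable {A}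

theorem V_eq_zero {f : Coord N → ℝ} {φ : A.SmoothRing} (h : A.Rep (fun x _ => f x) φ)
    (i : Fin N) : A.V i φ = 0 :=
  ext_ev fun x y hxy => by
    rw [← h.pdY i x y hxy, FinslerAngle.pdY, pd]
    simp

end ConformallyAutomorphicSpace

namespace ConformallyAutomorphicSpace

open Matrix

variable {N : ℕ} (A : ConformallyAutomorphicSpace N)

/-! ### The Riemannian metric and its connection -/

theorem exists_rep_a (m n : Fin N) : ∃ φ, A.Rep (fun x _ => A.a x m n) φ :=
  A.exists_rep ((A.smooth_a m n).comp contDiffOn_fst fun _ hz => A.mem_U_of_mem_D _ _ hz)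

/-- The metric `a_{mn}` as a matrix of smooth functions. -/
noncomputable def aR : Matrix (Fin N) (Fin N) A.SmoothRing :=
  Matrix.of fun m n => (A.exists_rep_a m n).choose

theorem rep_a (m n : Fin N) : A.Rep (fun x _ => A.a x m n) (A.aR m n) :=
  (A.exists_rep_a m n).choose_spec

theorem aR_transpose : A.aRᵀ = A.aR := by
  refine Matrix.ext fun m n => ext_ev fun x y h => ?_
  rw [transpose_apply, ← A.rep_a m n x y h, ← A.rep_a n m x y h]
  simpa using (A.posDef_a x (A.mem_U_of_mem_D x y h)).1.apply m n

theorem isUnit_det_aR : IsUnit A.aR.det :=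
  Rep.isUnit_det (B := fun x _ => A.a x) A.rep_a fun x y h =>
    (A.posDef_a x (A.mem_U_of_mem_D x y h)).det_pos.ne'

theorem rep_aInv (m n : Fin N) : A.Rep (fun x _ => (A.a x)⁻¹ m n) (A.aR⁻¹ m n) :=
  Rep.matrix_inv (B := fun x _ => A.a x) A.rep_a A.isUnit_det_aR m n

/-- The matrix `(Γ^i_{kl})_{ik}` of Christoffel symbols. -/
noncomputable def GR (l : Fin N) : Matrix (Fin N) (Fin N) A.SmoothRing :=
  christoffelMat A.X A.aR l

theorem rep_christoffel (i k n : Fin N) :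
    A.Rep (fun x _ => christoffel A.a i k n x) (A.GR n i k) := by
  have h := Rep.const_mul (1 / 2) (Rep.sum (s := Finset.univ) fun m =>
    (A.rep_aInv i m).mul ((((A.rep_a m k).pdX n).add ((A.rep_a m n).pdX k)).sub
      ((A.rep_a k n).pdX m)))
  have e : A.GR n i k = (1 / 2 : ℝ) • ∑ m, A.aR⁻¹ i m *
      (A.X n (A.aR m k) + A.X k (A.aR m n) - A.X m (A.aR k n)) := by
    rw [GR, christoffelMat, Matrix.mul_apply, Finset.smul_sum]
    exact Finset.sum_congr rfl fun m _ => by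
      rw [of_apply]; exact mul_smul_comm _ _ _
  rw [e]
  exact h

/-- The matrix `(a_n^i_{km})_{in}` of the Riemannian curvature tensor. -/
noncomputable def RR (k m : Fin N) : Matrix (Fin N) (Fin N) A.SmoothRing :=
  curvMat A.X A.GR k m

theorem rep_riemCurv (n i k m : Fin N) :
    A.Rep (fun x _ => riemCurv A.a n i k m x) (A.RR k m i n) := by
  have h := (((A.rep_christoffel i n m).pdX k).sub ((A.rep_christoffel i n k).pdX m)).add
    (Rep.sum (s := Finset.univ) fun u =>
      ((A.rep_christoffel u n m).mul (A.rep_christoffel i u k)).sub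
        ((A.rep_christoffel u n k).mul (A.rep_christoffel i u m)))
  have e : A.RR k m i n = A.X k (A.GR m i n) - A.X m (A.GR k i n) +
      ∑ u, (A.GR m u n * A.GR k i u - A.GR k u n * A.GR m i u) := by
    simp only [RR, curvMat, Matrix.sub_apply, Matrix.add_apply, Matrix.map_apply,
      Matrix.mul_apply, Finset.sum_sub_distrib, mul_comm, add_sub_assoc]
  rw [e]
  exact h

/-! ### The transformation -/

theorem exists_rep_t (m : Fin N) : ∃ φ, A.Rep (fun x y => A.t x y m) φ :=
  A.exists_rep (contDiffOn_pi.1 A.smooth_t m)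

/-- The transformation `t^m`. -/
noncomputable def tR (m : Fin N) : A.SmoothRing := (A.exists_rep_t m).choose

theorem rep_t (m : Fin N) : A.Rep (fun x y => A.t x y m) (A.tR m) :=
  (A.exists_rep_t m).choose_spec

/-- The matrix `t^m_k`. -/
noncomputable def TR : Matrix (Fin N) (Fin N) A.SmoothRing :=
  Matrix.of fun m k => A.V k (A.tR m)

theorem rep_tD (m k : Fin N) : A.Rep (A.tD m k) (A.TR m k) := (A.rep_t m).pdY k

theorem rep_tDD (h k m : Fin N) : A.Rep (A.tDD h k m) (A.V m (A.TR h k)) := (A.rep_tD h k).pdY m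

/-- The chain rule for y(x, t(x, y)) = y with x fixed. From here on the inverse transformation
enters only through the matrix `TR⁻¹`. -/
theorem yD_mul_tD {x y : Coord N} (h : (x, y) ∈ A.D) :
    (Matrix.of fun n m => A.yD n m x y) * (Matrix.of fun m k => A.tD m k x y) = 1 := by
  have hy : DifferentiableAt ℝ (A.yInv x) (A.t x y) := by
    have h1 := (A.smooth_yInv.contDiffAt (A.isOpen_D'.mem_nhds (A.t_mem x y h))).differentiableAt
      (by simp)
    exact h1.comp (f := fun τ => (x, τ)) (A.t x y) (by fun_prop)
  have ht : DifferentiableAt ℝ (A.t x) y := by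
    have h1 := (A.smooth_t.contDiffAt (A.isOpen_D.mem_nhds h)).differentiableAt (by simp)
    exact h1.comp (f := fun y' => (x, y')) y (by fun_prop)
  have hc := hy.hasFDerivAt.comp y ht.hasFDerivAt
  -- The inverse relation holds only on D, whose fibre over x is open.
  have hev : (A.yInv x ∘ A.t x) =ᶠ[nhds y] id := by
    have : ∀ᶠ y' in nhds y, (x, y') ∈ A.D :=
      (Continuous.prodMk_right x).continuousAt.eventually (A.isOpen_D.mem_nhds h)
    filter_upwards [this] with y' hy'
    exact A.left_inv x y' hy'
  have hid := (hc.congr_of_eventuallyEq hev.symm).unique (hasFDerivAt_id y)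
  ext n k
  have h2 := congrFun (congrArg (fun L : Coord N →L[ℝ] Coord N => L (Pi.single k 1)) hid) n
  simp only [ContinuousLinearMap.comp_apply, ContinuousLinearMap.id_apply] at h2
  have h3 : fderiv ℝ (A.t x) y (Pi.single k 1) =
      ∑ m, A.tD m k x y • (Pi.single m 1 : Coord N) := by
    ext m
    have : A.tD m k x y = fderiv ℝ (A.t x) y (Pi.single k 1) m := by
      rw [tD, pdY, pd, fderiv_apply ht]
      rfl
    simp [this, Finset.sum_apply, Pi.single_apply]
  rw [h3, map_sum, Finset.sum_apply] at h2
  have h4 : (1 : Matrix (Fin N) (Fin N) ℝ) n k = (Pi.single k 1 : Coord N) n := by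
    rw [Matrix.one_apply, Pi.single_apply]
  rw [Matrix.mul_apply, h4]
  refine Eq.trans ?_ h2
  refine Finset.sum_congr rfl fun m _ => ?_
  rw [Matrix.of_apply, Matrix.of_apply, map_smul, Pi.smul_apply, smul_eq_mul, mul_comm, yD, pdY,
    pd, fderiv_apply hy]
  rfl

theorem isUnit_det_TR : IsUnit A.TR.det :=
  Rep.isUnit_det (B := fun x y => Matrix.of fun m k => A.tD m k x y) A.rep_tD fun x y h h0 => by
    have := congrArg Matrix.det (A.yD_mul_tD h)
    rw [det_mul, h0, mul_zero, det_one] at this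
    exact zero_ne_one this

theorem rep_yD (n m : Fin N) : A.Rep (A.yD n m) (A.TR⁻¹ n m) := fun x y h => by
  refine Eq.trans ?_ (Rep.matrix_inv (B := fun x y => Matrix.of fun m k => A.tD m k x y) A.rep_tD
    A.isUnit_det_TR n m x y h)
  beta_reduce
  rw [Matrix.inv_eq_left_inv (A.yD_mul_tD h)]
  rfl

/-! ### The connection -/

/-- The coefficients `N^m_n`, as a vector for each `n`. -/
noncomputable def NR (n : Fin N) : Fin N → A.SmoothRing :=
  -(A.TR⁻¹ *ᵥ (A.X n ∘ A.tR + A.GR n *ᵥ A.tR))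

theorem rep_Nc (m n : Fin N) : A.Rep (A.Nc m n) (A.NR n m) :=
  Rep.neg (Rep.sum fun i => (A.rep_yD m i).mul (((A.rep_t i).pdX n).add
    (Rep.sum fun k => (A.rep_christoffel i k n).mul (A.rep_t k))))

/-- The matrix `(D^m_{nk})_{mk}`. -/
noncomputable def DR (n : Fin N) : Matrix (Fin N) (Fin N) A.SmoothRing :=
  Matrix.of fun m k => -A.V k (A.NR n m)

theorem rep_Dc (m n k : Fin N) : A.Rep (A.Dc m n k) (A.DR n m k) := ((A.rep_Nc m n).pdY k).neg

/-- The derivation `d_i`. -/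
noncomputable def dR (i : Fin N) : Derivation ℝ A.SmoothRing A.SmoothRing :=
  A.X i + ∑ k, A.NR i k • A.V k

variable {A} in
theorem dR_apply (i : Fin N) (φ : A.SmoothRing) :
    A.dR i φ = A.X i φ + ∑ k, A.NR i k * A.V k φ := by
  have h : ∀ s : Finset (Fin N), (∑ k ∈ s, A.NR i k • A.V k) φ = ∑ k ∈ s, A.NR i k * A.V k φ :=
    fun s => by
      induction s using Finset.cons_induction with
      | empty => simp
      | cons k s hk ih => rw [Finset.sum_cons, Finset.sum_cons, Derivation.add_apply, ih]; rfl
  rw [dR, Derivation.add_apply, h]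

variable {A} in
theorem Rep.d {f : Coord N → Coord N → ℝ} {φ : A.SmoothRing} (h : A.Rep f φ) (i : Fin N) :
    A.Rep (A.d i f) (A.dR i φ) := by
  rw [dR_apply]
  exact (h.pdX i).add (Rep.sum fun k => (A.rep_Nc k i).mul (h.pdY k))

/-- The vector `(M^n_{ij})_n`. -/
noncomputable def MR (i j : Fin N) : Fin N → A.SmoothRing :=
  A.dR i ∘ A.NR j - A.dR j ∘ A.NR i

theorem rep_M (n i j : Fin N) : A.Rep (A.M n i j) (A.MR i j n) :=
  ((A.rep_Nc n j).d i).sub ((A.rep_Nc n i).d j)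

/-- The matrix `(E_k^n_{ij})_{nk}`. -/
noncomputable def ER (i j : Fin N) : Matrix (Fin N) (Fin N) A.SmoothRing :=
  curvMat A.dR A.DR i j

theorem rep_E (k n i j : Fin N) : A.Rep (A.E k n i j) (A.ER i j n k) := by
  have h := (((A.rep_Dc n j k).d i).sub ((A.rep_Dc n i k).d j)).add
    (Rep.sum (s := Finset.univ) fun m =>
      ((A.rep_Dc m j k).mul (A.rep_Dc n i m)).sub ((A.rep_Dc m i k).mul (A.rep_Dc n j m)))
  have e : A.ER i j n k = A.dR i (A.DR j n k) - A.dR j (A.DR i n k) +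
      ∑ m, (A.DR j m k * A.DR i n m - A.DR i m k * A.DR j n m) := by
    simp only [ER, curvMat, Matrix.sub_apply, Matrix.add_apply, Matrix.map_apply,
      Matrix.mul_apply, Finset.sum_sub_distrib, mul_comm, add_sub_assoc]
  rw [e]
  exact h

/-! ### The Finsler metric tensor -/

theorem exists_rep_F : ∃ φ, A.Rep A.F φ := A.exists_rep A.smooth_F

/-- The Finsler metric function. -/
noncomputable def FR : A.SmoothRing := A.exists_rep_F.choose

theorem rep_F : A.Rep A.F A.FR := A.exists_rep_F.choose_spec

theorem exists_rep_y (k : Fin N) : ∃ φ, A.Rep (fun _ y => y k) φ :=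
  A.exists_rep (contDiffOn_pi.1 contDiffOn_snd k)

/-- The coordinate `y^k`. -/
noncomputable def yR (k : Fin N) : A.SmoothRing := (A.exists_rep_y k).choose

theorem rep_y (k : Fin N) : A.Rep (fun _ y => y k) (A.yR k) := (A.exists_rep_y k).choose_spec

/-- The covector `y_k`. -/
noncomputable def yLowR (k : Fin N) : A.SmoothRing := (1 / 2 : ℝ) • A.V k (A.FR ^ 2)

theorem rep_F_sq : A.Rep (fun x y => A.F x y ^ 2) (A.FR ^ 2) := fun x y h => by
  simp only [map_pow, A.rep_F x y h]

theorem rep_covector (k : Fin N) : A.Rep (covector A.F k) (A.yLowR k) :=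
  (A.rep_F_sq.pdY k).const_mul _

/-- The metric tensor `g_{ij}`. -/
noncomputable def gR : Matrix (Fin N) (Fin N) A.SmoothRing :=
  Matrix.of fun i j => A.V j (A.yLowR i)

theorem rep_metric (i j : Fin N) : A.Rep (fun x y => metric A.F x y i j) (A.gR i j) :=
  (A.rep_covector i).pdY j

theorem rep_g (i j : Fin N) : A.Rep (A.g i j) (A.gR i j) := A.rep_metric i j

theorem isUnit_det_gR : IsUnit A.gR.det := Rep.isUnit_det A.rep_metric A.metric_nondegenerate

theorem rep_gUp (i j : Fin N) : A.Rep (A.gUp i j) (A.gR⁻¹ i j) :=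
  Rep.matrix_inv A.rep_metric A.isUnit_det_gR i j

/-- The Cartan tensor `(C_{mnk})_{mn}`. -/
noncomputable def CR (k : Fin N) : Matrix (Fin N) (Fin N) A.SmoothRing :=
  (1 / 2 : ℝ) • A.gR.map (A.V k)

theorem rep_C (m n k : Fin N) : A.Rep (A.C m n k) (A.CR k m n) :=
  ((A.rep_g m n).pdY k).const_mul _

theorem rep_CUp (n h k : Fin N) : A.Rep (A.CUp n h k) ((A.gR⁻¹ * A.CR k) n h) :=
  Rep.sum fun m => (A.rep_gUp n m).mul (A.rep_C m h k)

/-- The matrix `(ρ_k^n_{ij})_{nk}`. -/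
noncomputable def rhoR (i j : Fin N) : Matrix (Fin N) (Fin N) A.SmoothRing :=
  Matrix.of fun n k => A.ER i j n k - ∑ h, A.MR i j h * (A.gR⁻¹ * A.CR k) n h

theorem rep_rho (k n i j : Fin N) : A.Rep (A.rho k n i j) (A.rhoR i j n k) :=
  (A.rep_E k n i j).sub (Rep.sum fun h => (A.rep_M h i j).mul (A.rep_CUp n h k))

theorem rep_covM (k n i j : Fin N) : A.Rep (A.covM k n i j)
    (A.dR k (A.MR i j n) + (A.DR k *ᵥ A.MR i j) n - ∑ s, A.GR i s k * A.MR s j n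
      - ∑ s, A.GR j s k * A.MR i s n) :=
  ((((A.rep_M n i j).d k).add (Rep.sum fun s => (A.rep_Dc n k s).mul (A.rep_M s i j))).sub
    (Rep.sum fun s => (A.rep_christoffel s k i).mul (A.rep_M n s j))).sub
    (Rep.sum fun s => (A.rep_christoffel s k j).mul (A.rep_M n i s))

theorem rep_covRho (l k n i j : Fin N) : A.Rep (A.covRho l k n i j)
    (A.dR l (A.rhoR i j n k) + (A.DR l * A.rhoR i j) n k - ∑ s, A.DR l s k * A.rhoR i j n s
      - ∑ s, A.GR i s l * A.rhoR s j n k - ∑ s, A.GR j s l * A.rhoR i s n k) :=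
  (((((A.rep_rho k n i j).d l).add (Rep.sum fun s => (A.rep_Dc n l s).mul (A.rep_rho k s i j))).sub
    (Rep.sum fun s => (A.rep_Dc s l k).mul (A.rep_rho s n i j))).sub
    (Rep.sum fun s => (A.rep_christoffel s l i).mul (A.rep_rho k n s j))).sub
    (Rep.sum fun s => (A.rep_christoffel s l j).mul (A.rep_rho k n i s))

/-! ### Structural equations of the connection -/

theorem V_aR (k m n : Fin N) : A.V k (A.aR m n) = 0 := V_eq_zero (A.rep_a m n) k

theorem V_GR (k l m n : Fin N) : A.V k (A.GR l m n) = 0 := V_eq_zero (A.rep_christoffel m n l) k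

theorem V_RR (k i j m n : Fin N) : A.V k (A.RR i j m n) = 0 := V_eq_zero (A.rep_riemCurv n m i j) k

variable {A} in
theorem dR_eq_X {φ : A.SmoothRing} (h : ∀ k, A.V k φ = 0) (i : Fin N) : A.dR i φ = A.X i φ := by
  simp [dR_apply, h]

theorem GR_map_dR (i l : Fin N) : (A.GR l).map (A.dR i) = (A.GR l).map (A.X i) :=
  Matrix.ext fun m n => dR_eq_X (fun k => A.V_GR k l m n) i

theorem RR_map_dR (l i j : Fin N) : (A.RR i j).map (A.dR l) = (A.RR i j).map (A.X l) :=
  Matrix.ext fun m n => dR_eq_X (fun k => A.V_RR k i j m n) l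

theorem RR_eq_curvMat_dR (i j : Fin N) : A.RR i j = curvMat A.dR A.GR i j := by
  rw [RR, curvMat, curvMat, GR_map_dR, GR_map_dR]

theorem aR_map_dR (l : Fin N) : A.aR.map (A.dR l) = (A.GR l)ᵀ * A.aR + A.aR * A.GR l := by
  have h : A.aR.map (A.dR l) = A.aR.map (A.X l) :=
    Matrix.ext fun m n => dR_eq_X (fun k => A.V_aR k m n) l
  rw [h]
  exact christoffelMat_compat A.aR_transpose A.isUnit_det_aR l

theorem RR_swap (i j : Fin N) : A.RR j i = -A.RR i j := curvMat_swap _ _ i j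

theorem RR_antisymm (i j : Fin N) : (A.RR i j)ᵀ * A.aR + A.aR * A.RR i j = 0 :=
  curvMat_antisymm X_comm (fun l => christoffelMat_compat A.aR_transpose A.isUnit_det_aR l) i j

theorem GR_symm (l i k : Fin N) : A.GR l i k = A.GR k i l :=
  christoffelMat_symm A.aR_transpose i k l

theorem TR_mul_inv : A.TR * A.TR⁻¹ = 1 := mul_nonsing_inv _ A.isUnit_det_TR

theorem inv_mul_TR : A.TR⁻¹ * A.TR = 1 := nonsing_inv_mul _ A.isUnit_det_TR

/-- This is the purpose of N: since d_n t = ∂t/∂x^n + T N_n, the coefficients solve exactly this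
equation, and t becomes parallel. -/
theorem dR_comp_tR (n : Fin N) : A.dR n ∘ A.tR = -(A.GR n *ᵥ A.tR) := by
  have h : A.dR n ∘ A.tR = A.X n ∘ A.tR + A.TR *ᵥ A.NR n := by
    funext m
    simp only [Function.comp_apply, dR_apply, Pi.add_apply, mulVec, dotProduct, TR, of_apply,
      mul_comm]
  rw [h, NR, mulVec_neg, mulVec_mulVec, TR_mul_inv, one_mulVec]
  abel

variable {A} in
-- The coefficients D are those of the commutator of d_i with ∂/∂y^k: only the factor N in d_i
-- depends on y.
theorem dR_V (i k : Fin N) (φ : A.SmoothRing) :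
    A.dR i (A.V k φ) = A.V k (A.dR i φ) + ∑ m, A.DR i m k * A.V m φ := by
  simp only [dR_apply, map_add, map_sum, Derivation.leibniz, smul_eq_mul, DR, of_apply, X_V_comm,
    Finset.sum_add_distrib, neg_mul, Finset.sum_neg_distrib, V_comm k]
  simp only [mul_comm]
  abel

/-- The y-derivative of `dR_comp_tR`, with Γ independent of y and the commutator supplied by `dR_V`.
-/
theorem TR_map_dR (l : Fin N) : A.TR.map (A.dR l) = -(A.GR l * A.TR) + A.TR * A.DR l := by
  ext1 h k
  have e : A.dR l (A.tR h) = -(A.GR l *ᵥ A.tR) h := congrFun (A.dR_comp_tR l) h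
  simp only [map_apply, TR, of_apply, dR_V, e, Matrix.add_apply, Matrix.neg_apply, mul_apply,
    map_neg, mulVec, dotProduct, map_sum, Derivation.leibniz, V_GR, smul_eq_mul, mul_zero,
    add_zero]
  simp only [mul_comm]

theorem TR_inv_map_dR (l : Fin N) :
    A.TR⁻¹.map (A.dR l) = A.TR⁻¹ * A.GR l - A.DR l * A.TR⁻¹ := by
  have h := congrArg (fun B => A.TR⁻¹ * B.map (A.dR l)) A.TR_mul_inv
  have h1 : (1 : Matrix (Fin N) (Fin N) A.SmoothRing).map (A.dR l) = 0 := by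
    ext1 i j
    rw [map_apply, one_apply]
    split_ifs <;> simp
  simp only [map_derivation_mul, TR_map_dR, h1, Matrix.mul_zero, Matrix.mul_add,
    Matrix.add_mul, ← Matrix.mul_assoc, inv_mul_TR, Matrix.one_mul, Matrix.neg_mul,
    Matrix.mul_neg] at h
  simp only [Matrix.mul_assoc, TR_mul_inv, Matrix.mul_one] at h
  rw [← sub_eq_zero, ← h]
  abel

variable {A} in
theorem dR_comm (i j : Fin N) (φ : A.SmoothRing) :
    A.dR i (A.dR j φ) - A.dR j (A.dR i φ) = ∑ n, A.MR i j n * A.V n φ := by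
  have h : ∀ i j, A.dR i (A.dR j φ) = A.X i (A.X j φ) + ∑ k, A.NR i k * A.X j (A.V k φ)
      + ∑ k, A.NR j k * A.X i (A.V k φ) + ∑ k, A.dR i (A.NR j k) * A.V k φ
      + ∑ k, ∑ l, A.NR j k * (A.NR i l * A.V l (A.V k φ)) := fun i j => by
    rw [dR_apply j, map_add, map_sum]
    simp only [Derivation.leibniz, smul_eq_mul, Finset.sum_add_distrib]
    rw [dR_apply i (A.X j φ)]
    simp only [dR_apply i (A.V _ φ), mul_add, Finset.sum_add_distrib, Finset.mul_sum, X_V_comm j,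
      mul_comm (A.V _ φ)]
    abel
  rw [h i j, h j i, X_comm i j, Finset.sum_comm (f := fun k l => A.NR i k * _)]
  simp only [MR, Pi.sub_apply, Function.comp_apply, sub_mul, Finset.sum_sub_distrib]
  -- The terms of second order in ∂/∂y are symmetric in i and j, so they leave the commutator.
  have e : ∑ k, ∑ l, A.NR j k * (A.NR i l * A.V l (A.V k φ)) =
      ∑ k, ∑ l, A.NR i l * (A.NR j k * A.V k (A.V l φ)) := by
    refine Finset.sum_congr rfl fun k _ => Finset.sum_congr rfl fun l _ => ?_
    rw [V_comm l k]; ring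
  rw [e]
  abel

/-- Evaluate the commutator of d_i and d_j on t in two ways: as the vertical field M, and by
iterating d t = -Γ t. -/
theorem TR_mulVec_MR (i j : Fin N) : A.TR *ᵥ A.MR i j = -(A.RR i j *ᵥ A.tR) := by
  have h : A.TR *ᵥ A.MR i j = A.dR i ∘ (A.dR j ∘ A.tR) - A.dR j ∘ (A.dR i ∘ A.tR) := by
    funext h
    simp only [Pi.sub_apply, Function.comp_apply, dR_comm, mulVec, dotProduct, TR, of_apply,
      mul_comm]
  have hn : ∀ (l : Fin N) (v : Fin N → A.SmoothRing), A.dR l ∘ (-v) = -(A.dR l ∘ v) :=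
    fun l v => funext fun _ => map_neg _ _
  rw [h, dR_comp_tR, dR_comp_tR, hn, hn, comp_derivation_mulVec, comp_derivation_mulVec,
    dR_comp_tR, dR_comp_tR, RR_eq_curvMat_dR, curvMat]
  simp only [mulVec_neg, mulVec_mulVec, sub_mulVec, add_mulVec]
  abel

theorem MR_eq (i j : Fin N) : A.MR i j = -((A.TR⁻¹ * A.RR i j) *ᵥ A.tR) := by
  rw [← one_mulVec (A.MR i j), ← inv_mul_TR, ← mulVec_mulVec, TR_mulVec_MR, mulVec_neg,
    mulVec_mulVec]

/-- Moving d_i past ∂/∂y^k in d_i D_j produces the product D_j D_i. These products cancel the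
quadratic part of the curvature. -/
theorem ER_apply (i j n k : Fin N) : A.ER i j n k = -A.V k (A.MR i j n) := by
  have h : ∀ i j, A.dR i (A.DR j n k) = -A.V k (A.dR i (A.NR j n)) + (A.DR j * A.DR i) n k :=
    fun i j => by
      rw [mul_apply, DR, of_apply, map_neg, dR_V, neg_add, ← Finset.sum_neg_distrib]
      simp only [DR, of_apply]
      congr 1
      exact Finset.sum_congr rfl fun m _ => by ring
  simp only [ER, curvMat, Matrix.sub_apply, Matrix.add_apply, Matrix.map_apply, h, MR,
    Pi.sub_apply, Function.comp_apply, map_sub]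
  ring

/-- Differentiate T M = -R t along y^k. R depends on x only, and ∂t^h_m/∂y^k is symmetric in m and
k. -/
theorem TR_mul_ER (i j h k : Fin N) :
    (A.TR * A.ER i j) h k = ∑ m, A.V m (A.TR h k) * A.MR i j m + (A.RR i j * A.TR) h k := by
  have e := congrArg (A.V k) (congrFun (A.TR_mulVec_MR i j) h)
  have hc : ∀ m, A.V k (A.TR h m) = A.V m (A.TR h k) := fun m => V_comm k m _
  have ht : ∀ m, A.V k (A.tR m) = A.TR m k := fun m => rfl
  simp only [mulVec, dotProduct, Pi.neg_apply, map_sum, map_neg, Derivation.leibniz, smul_eq_mul,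
    V_RR, mul_zero, add_zero, hc, ht, Finset.sum_add_distrib] at e
  simp only [mul_apply, ER_apply, mul_neg, Finset.sum_neg_distrib]
  simp only [mul_comm (A.MR i j _)] at e
  linear_combination -e

end ConformallyAutomorphicSpace

/-- Halving is available in an ℝ-algebra; this allows factors 2 to be written as sums a + a. -/
theorem add_self_cancel_of_algebra {R : Type*} [CommRing R] [Algebra ℝ R] {a b : R}
    (h : a + a = b + b) : a = b := by
  have e : ∀ c : R, c = (1 / 2 : ℝ) • (c + c) := fun c => by module
  rw [e a, e b, h]

open Matrix in
theorem Matrix.congruence_apply {R n : Type*} [CommRing R] [Fintype n] (T a : Matrix n n R)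
    (i j : n) : (Tᵀ * a * T) i j = ∑ k, ∑ l, a k l * T k i * T l j := by
  simp only [Matrix.mul_apply, Matrix.transpose_apply, Finset.sum_mul]
  rw [Finset.sum_comm]
  exact Finset.sum_congr rfl fun k _ => Finset.sum_congr rfl fun l _ => by ring

namespace ConformallyAutomorphicSpace

open Matrix

variable {N : ℕ} (A : ConformallyAutomorphicSpace N)

/-! ### Consequences of homogeneity and conformality -/

variable {A} in
-- Euler's theorem, from the derivative of k ↦ f(x, ky) at k = 1.
theorem Rep.euler {f : Coord N → Coord N → ℝ} {φ : A.SmoothRing} (h : A.Rep f φ) {α : ℝ}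
    (hf : ∀ x y, (x, y) ∈ A.D → ∀ k : ℝ, 0 < k → f x (k • y) = k ^ α * f x y) :
    ∑ n, A.V n φ * A.yR n = α • φ := by
  refine ext_ev fun x y hxy => ?_
  have hd : DifferentiableAt ℝ (f x) y := by
    have h1 := h.uncurry.differentiableAt ⟨(x, y), hxy⟩
    exact h1.comp (f := fun y' => (x, y')) y (by fun_prop)
  have h1 : HasDerivAt (fun k : ℝ => f x (k • y)) (fderiv ℝ (f x) y y) 1 := by
    have h2 : HasDerivAt (fun k : ℝ => k • y) y 1 := by
      simpa using (hasDerivAt_id (1 : ℝ)).smul_const y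
    have h3 : HasFDerivAt (f x) (fderiv ℝ (f x) y) ((1 : ℝ) • y) := by
      rw [one_smul]; exact hd.hasFDerivAt
    exact h3.comp_hasDerivAt 1 h2
  have h4 : HasDerivAt (fun k : ℝ => k ^ α * f x y) (α * f x y) 1 := by
    simpa using (Real.hasDerivAt_rpow_const (x := 1) (p := α) (Or.inl one_ne_zero)).mul_const
      (f x y)
  have h5 := (h4.congr_of_eventuallyEq (by
    filter_upwards [lt_mem_nhds (zero_lt_one' ℝ)] with k hk using hf x y hxy k hk)).unique h1
  have h6 : y = ∑ n, y n • (Pi.single n 1 : Coord N) := by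
    ext m
    simp [Finset.sum_apply, Pi.single_apply]
  rw [map_sum, map_smul, smul_eq_mul, ← h x y hxy, h5]
  conv_rhs => rw [h6, map_sum, ← h6]
  refine Finset.sum_congr rfl fun n _ => ?_
  rw [map_mul, ← h.pdY n x y hxy, ← A.rep_y n x y hxy, map_smul, smul_eq_mul, mul_comm]
  rfl

theorem TR_mulVec_yR : A.TR *ᵥ A.yR = A.H • A.tR := by
  funext m
  refine (A.rep_t m).euler fun x y h k hk => ?_
  rw [A.t_homog x y h k hk]; rfl

theorem V_yR (k m : Fin N) : A.V k (A.yR m) = if k = m then 1 else 0 := by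
  refine ext_ev fun x y h => ?_
  rw [← (A.rep_y m).pdY k x y h, pdY, pd]
  have : fderiv ℝ (fun y' : Coord N => y' m) y = ContinuousLinearMap.proj m :=
    (ContinuousLinearMap.proj (R := ℝ) (φ := fun _ : Fin N => ℝ) m).fderiv
  rw [this]
  by_cases hk : k = m <;> simp [hk, eq_comm]

theorem sum_V_FR_sq : ∑ m, A.V m (A.FR ^ 2) * A.yR m = A.FR ^ 2 + A.FR ^ 2 := by
  have h := A.rep_F_sq.euler (α := 2) fun x y h k hk => by
    rw [A.F_homog x y h k hk, mul_pow, Real.rpow_two]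
  rw [h, two_smul]

theorem V_FR_sq (k : Fin N) : A.V k (A.FR ^ 2) = A.yLowR k + A.yLowR k := by
  rw [yLowR]; module

theorem yLowR_dotProduct_yR : A.yLowR ⬝ᵥ A.yR = A.FR ^ 2 := by
  apply add_self_cancel_of_algebra
  rw [← sum_V_FR_sq]
  simp only [V_FR_sq, add_mul, Finset.sum_add_distrib, dotProduct]

theorem gR_symm (i j : Fin N) : A.gR i j = A.gR j i := by
  simp only [gR, of_apply, yLowR, Derivation.map_smul, V_comm i j]

/-- Differentiate y_i y^i = F² along y^k: the right side gives 2 y_k, and one y_k cancels. -/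
theorem gR_mulVec_yR : A.gR *ᵥ A.yR = A.yLowR := by
  funext k
  have h := congrArg (A.V k) A.yLowR_dotProduct_yR
  rw [V_FR_sq] at h
  simp only [dotProduct, map_sum, Derivation.leibniz, V_yR, smul_eq_mul, mul_ite, mul_one,
    mul_zero, Finset.sum_add_distrib, Finset.sum_ite_eq, Finset.mem_univ, if_true] at h
  have h2 : ∑ i, A.yR i * A.V k (A.yLowR i) = (A.gR *ᵥ A.yR) k := by
    simp only [mulVec, dotProduct]
    refine Finset.sum_congr rfl fun i _ => ?_
    rw [gR_symm, mul_comm]; rfl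
  rw [h2] at h
  have h3 := add_left_cancel h
  rw [h3]

/-- The squared Riemannian length of `t`. -/
noncomputable def sqLen : A.SmoothRing := A.tR ⬝ᵥ A.aR *ᵥ A.tR

theorem rep_sqLen :
    A.Rep (fun x y => ∑ m, ∑ n, A.a x m n * A.t x y m * A.t x y n) A.sqLen := fun x y h => by
  simp only [sqLen, dotProduct, mulVec, map_sum, map_mul, Finset.mul_sum, ← A.rep_a _ _ x y h,
    ← A.rep_t _ x y h]
  exact Finset.sum_congr rfl fun m _ => Finset.sum_congr rfl fun n _ => by ring

/-- In other words S = F^H. The vector y/F lies on the indicatrix, so its image F^{-H} t has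
Riemannian length 1. -/
theorem ev_sqLen {x y : Coord N} (h : (x, y) ∈ A.D) :
    A.ev h A.sqLen = (A.F x y ^ A.H) ^ 2 := by
  have hF := A.F_pos x y h
  have hk := inv_pos.2 hF
  have h1 := A.smul_mem_D x y h _ hk
  have h2 : riemNorm A.a x (A.t x ((A.F x y)⁻¹ • y)) = 1 := by
    rw [← A.indicatrix _ _ h1, A.F_homog x y h _ hk, inv_mul_cancel₀ hF.ne']
  rw [riemNorm, Real.sqrt_eq_one] at h2
  rw [← A.rep_sqLen x y h]
  rw [A.t_homog x y h _ hk] at h2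
  have hp : 0 < A.F x y ^ A.H := Real.rpow_pos_of_pos hF _
  have h3 : ∑ m, ∑ n, A.a x m n * A.t x y m * A.t x y n * ((A.F x y ^ A.H)⁻¹) ^ 2 = 1 := by
    rw [← h2]
    refine Finset.sum_congr rfl fun m _ => Finset.sum_congr rfl fun n _ => ?_
    rw [Pi.smul_apply, Pi.smul_apply, smul_eq_mul, smul_eq_mul, Real.inv_rpow hF.le]
    ring
  simp only [← Finset.sum_mul] at h3
  field_simp at h3
  exact h3

theorem riemNorm_sq {x y : Coord N} (h : (x, y) ∈ A.D) :
    riemNorm A.a x (A.t x y) ^ 2 = (A.F x y ^ A.H) ^ 2 := by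
  have := A.rep_sqLen x y h
  rw [ev_sqLen] at this
  beta_reduce at this
  rw [riemNorm, Real.sq_sqrt (by rw [this]; positivity), this]

theorem metric_eq {x y : Coord N} (h : (x, y) ∈ A.D) (m n : Fin N) : metric A.F x y m n =
    A.p x y ^ 2 * ∑ i, ∑ j, A.a x i j * A.tD i m x y * A.tD j n x y := by
  obtain ⟨c, hc⟩ := A.conformal
  obtain ⟨-, hc⟩ := hc x y h
  have hF := A.F_pos x y h
  have hH := A.H_pos
  have hp : 0 < A.F x y ^ A.H := Real.rpow_pos_of_pos hF _
  have ht : ∀ i, ∑ m, A.tD i m x y * y m = A.H * A.t x y i := fun i => by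
    have := congrArg (A.ev h) (congrFun A.TR_mulVec_yR i)
    simpa [mulVec, dotProduct, ← A.rep_tD _ _ x y h, ← A.rep_y _ x y h, ← A.rep_t _ x y h]
      using this
  -- The factor c is found by evaluating g(y, y) twice: it is F² by homogeneity of F, and c H² S² by
  -- conformality and T y = H t.
  have h1 : ∑ m, (∑ n, metric A.F x y m n * y n) * y m = A.F x y ^ 2 := by
    have := A.yLowR_dotProduct_yR
    rw [← gR_mulVec_yR] at this
    have := congrArg (A.ev h) this
    simpa [mulVec, dotProduct, ← A.rep_metric _ _ x y h, ← A.rep_y _ x y h, ← A.rep_F x y h]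
      using this
  have h2 : ∑ m, (∑ n, metric A.F x y m n * y n) * y m =
      c x y * A.H ^ 2 * (A.F x y ^ A.H) ^ 2 := by
    let T : Matrix (Fin N) (Fin N) ℝ := of fun m k => A.tD m k x y
    have hG : metric A.F x y = c x y • (Tᵀ * A.a x * T) := by
      ext m n
      rw [hc, Matrix.smul_apply, congruence_apply]
      rfl
    have hT : T *ᵥ y = A.H • A.t x y := funext ht
    have h3 : (metric A.F x y *ᵥ y) ⬝ᵥ y =
        c x y * A.H ^ 2 * ∑ m, ∑ n, A.a x m n * A.t x y m * A.t x y n := by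
      rw [hG, smul_mulVec, ← mulVec_mulVec, ← mulVec_mulVec, hT, smul_dotProduct, dotProduct_comm,
        dotProduct_mulVec, vecMul_transpose, hT, mulVec_smul, smul_dotProduct, dotProduct_smul]
      simp only [dotProduct, mulVec, smul_eq_mul, Finset.mul_sum]
      refine Finset.sum_congr rfl fun m _ => Finset.sum_congr rfl fun n _ => by ring
    rw [← ev_sqLen A h, ← A.rep_sqLen x y h]
    exact h3
  have h4 : c x y = A.p x y ^ 2 := by
    rw [h1] at h2
    have h5 : A.F x y ^ (1 - A.H) = A.F x y / A.F x y ^ A.H := by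
      rw [Real.rpow_sub hF, Real.rpow_one]
    rw [p, h5]
    field_simp
    linarith
  rw [hc, h4]
  rfl

/-! ### The Cartan tensor and the curvature tensor -/

theorem isUnit_FR : IsUnit A.FR := isUnit_of_ev_ne_zero fun x y h => by
  rw [← A.rep_F x y h]; exact (A.F_pos x y h).ne'

theorem isUnit_sqLen : IsUnit A.sqLen := isUnit_of_ev_ne_zero fun x y h => by
  rw [ev_sqLen]
  exact pow_ne_zero _ (Real.rpow_pos_of_pos (A.F_pos x y h) _).ne'

/-- The function `1 / F`. -/
noncomputable def FInv : A.SmoothRing := Ring.inverse A.FR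

theorem FR_mul_FInv : A.FR * A.FInv = 1 := Ring.mul_inverse_cancel _ A.isUnit_FR

theorem rep_FInv : A.Rep (fun x y => 1 / A.F x y) A.FInv := fun x y h => by
  have e := congrArg (A.ev h) A.FR_mul_FInv
  rw [map_mul, map_one, ← A.rep_F x y h] at e
  beta_reduce
  rw [one_div, inv_eq_of_mul_eq_one_right e]

/-- The conformal factor `p²`. -/
noncomputable def confR : A.SmoothRing :=
  (A.H⁻¹ ^ 2) • (A.FR ^ 2 * Ring.inverse A.sqLen)

theorem confR_mul_sqLen : A.H ^ 2 • (A.confR * A.sqLen) = A.FR ^ 2 := by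
  rw [confR, smul_mul_assoc, smul_smul, ← mul_pow, mul_inv_cancel₀ A.H_pos.ne', one_pow, one_smul,
    mul_assoc, Ring.inverse_mul_cancel _ A.isUnit_sqLen, mul_one]

/-- In the ring the factor is written F²/(H² S²), free of real powers; S = F^H turns it into p². -/
theorem rep_confR : A.Rep (fun x y => A.p x y ^ 2) A.confR := fun x y h => by
  have e := congrArg (A.ev h) A.confR_mul_sqLen
  rw [map_smul, map_mul, ev_sqLen, map_pow, ← A.rep_F x y h] at e
  have hF := A.F_pos x y h
  have hH := A.H_pos
  have hp : 0 < A.F x y ^ A.H := Real.rpow_pos_of_pos hF _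
  have h5 : A.F x y ^ (1 - A.H) = A.F x y / A.F x y ^ A.H := by
    rw [Real.rpow_sub hF, Real.rpow_one]
  beta_reduce
  rw [p, h5]
  rw [smul_eq_mul] at e
  field_simp
  linarith

theorem gR_eq : A.gR = A.confR • (A.TRᵀ * A.aR * A.TR) := by
  refine Matrix.ext fun m n => ext_ev fun x y h => ?_
  rw [← A.rep_metric m n x y h]
  beta_reduce
  rw [A.metric_eq h, Matrix.smul_apply, congruence_apply, smul_eq_mul,
    map_mul, ← A.rep_confR x y h]
  simp only [map_sum, map_mul, ← A.rep_a _ _ x y h, ← A.rep_tD _ _ x y h]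

/-- The covector `a_{ij} t^j`. -/
noncomputable def tLowR : Fin N → A.SmoothRing := A.aR *ᵥ A.tR

theorem yLowR_eq : A.yLowR = (A.H • A.confR) • (A.TRᵀ *ᵥ A.tLowR) := by
  rw [← gR_mulVec_yR, gR_eq, smul_mulVec, ← mulVec_mulVec, ← mulVec_mulVec, TR_mulVec_yR,
    mulVec_smul, mulVec_smul, tLowR, smul_comm, smul_assoc]

theorem V_sqLen (k : Fin N) :
    A.V k A.sqLen = (A.TRᵀ *ᵥ A.tLowR) k + (A.TRᵀ *ᵥ A.tLowR) k := by
  have ht : ∀ m, A.V k (A.tR m) = A.TR m k := fun m => rfl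
  have ha : ∀ m n, A.aR m n = A.aR n m := fun m n => congrFun (congrFun A.aR_transpose n) m
  simp only [sqLen, tLowR, dotProduct, mulVec, transpose_apply, map_sum, Derivation.leibniz,
    V_aR, ht, smul_eq_mul, mul_zero, add_zero, Finset.sum_add_distrib]
  congr 1
  · simp only [Finset.mul_sum]
    rw [Finset.sum_comm]
    refine Finset.sum_congr rfl fun m _ => Finset.sum_congr rfl fun n _ => ?_
    rw [ha n m]; ring
  · exact Finset.sum_congr rfl fun m _ => mul_comm _ _

/-- Differentiate H² p² S² = F², using y_k = H p² (Tᵀ t♭)_k to eliminate the derivative of S². -/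
theorem V_confR (k : Fin N) : A.V k A.confR =
    ((1 - A.H) • A.FInv ^ 2 * A.confR * A.yLowR k) +
    ((1 - A.H) • A.FInv ^ 2 * A.confR * A.yLowR k) := by
  have h := congrArg (A.V k) A.confR_mul_sqLen
  rw [Derivation.map_smul, Derivation.leibniz, V_sqLen, V_FR_sq] at h
  have h1 : A.yLowR k = A.H • A.confR * (A.TRᵀ *ᵥ A.tLowR) k := congrFun A.yLowR_eq k
  have h2 : A.FR ^ 2 * A.FInv ^ 2 = 1 := by rw [← mul_pow, FR_mul_FInv, one_pow]
  have h3 := A.confR_mul_sqLen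
  have e : ∀ r : ℝ, ∀ φ : A.SmoothRing, r • φ = algebraMap ℝ A.SmoothRing r * φ :=
    fun r φ => Algebra.smul_def r φ
  simp only [e, map_pow, map_sub, map_one, smul_eq_mul] at *
  set η := algebraMap ℝ A.SmoothRing A.H
  set u := (A.TRᵀ *ᵥ A.tLowR) k
  linear_combination (-A.V k A.confR) * h2 - A.FInv ^ 2 * A.V k A.confR * h3
    + A.FInv ^ 2 * A.confR * h + 2 * η * A.FInv ^ 2 * A.confR * h1

theorem gR_transpose : A.gRᵀ = A.gR := Matrix.ext fun i j => A.gR_symm j i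

theorem CR_symm (k m n : Fin N) : A.CR k m n = A.CR n m k := by
  simp only [CR, gR, Matrix.smul_apply, map_apply, of_apply, V_comm k n]

theorem CR_transpose (k : Fin N) : (A.CR k)ᵀ = A.CR k :=
  Matrix.ext fun i j => by
    simp only [CR, transpose_apply, Matrix.smul_apply, map_apply, A.gR_symm j i]

/-- The scalar `(1 - H) / F²`. -/
noncomputable def wR : A.SmoothRing := (1 - A.H) • A.FInv ^ 2

/-- The product rule for g = p² Tᵀ a T; a does not depend on y. -/
theorem CR_add_CR (k : Fin N) : A.CR k + A.CR k =
    (A.wR * A.yLowR k) • A.gR + (A.wR * A.yLowR k) • A.gR +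
      A.confR • (A.TRᵀ * A.aR * A.TR.map (A.V k)) +
      (A.confR • (A.TRᵀ * A.aR * A.TR.map (A.V k)))ᵀ := by
  have h : A.CR k + A.CR k = A.gR.map (A.V k) := by rw [CR]; module
  have ha : A.aR.map (A.V k) = 0 := Matrix.ext fun m n => A.V_aR k m n
  have e : A.gR.map (A.V k) = (A.confR • (A.TRᵀ * A.aR * A.TR)).map (A.V k) := by rw [← gR_eq]
  rw [h, e, map_derivation_smul, map_derivation_mul, map_derivation_mul, ha, V_confR, gR_eq,
    transpose_smul, transpose_mul, transpose_mul, transpose_transpose, aR_transpose,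
    transpose_map, ← wR, Matrix.mul_zero, add_zero, smul_add, smul_smul, add_smul,
    mul_right_comm, ← Matrix.mul_assoc]
  abel

/-- The Christoffel trick: p² Tᵀ a ∂_k T has a symmetric pair of lower indices, being built from
second derivatives of t. Since C is totally symmetric, three permutations of `CR_add_CR` determine
it. -/
theorem TR_inv_mul_V_TR (k n m : Fin N) : (A.confR • (A.TRᵀ * A.aR * A.TR.map (A.V k))) n m =
    A.CR k n m - A.wR * (A.yLowR k * A.gR n m + A.yLowR m * A.gR n k - A.yLowR n * A.gR m k) := by
  have hB : ∀ k n m, (A.confR • (A.TRᵀ * A.aR * A.TR.map (A.V k))) n m =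
      (A.confR • (A.TRᵀ * A.aR * A.TR.map (A.V m))) n k := fun k n m => by
    rw [Matrix.smul_apply, Matrix.smul_apply, mul_apply, mul_apply]
    congr 1
    exact Finset.sum_congr rfl fun h _ => congrArg _ (V_comm k m _)
  have h1 := congrFun (congrFun (A.CR_add_CR k) n) m
  have h2 := congrFun (congrFun (A.CR_add_CR m) n) k
  have h3 := congrFun (congrFun (A.CR_add_CR n) m) k
  apply add_self_cancel_of_algebra
  rw [Matrix.add_apply, Matrix.add_apply, Matrix.add_apply, Matrix.add_apply, transpose_apply,
    Matrix.smul_apply _ A.gR, smul_eq_mul] at h1 h2 h3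
  have s1 := A.CR_symm m n k
  have s2 : A.CR n m k = A.CR k n m := by
    rw [CR_symm, ← congrFun (congrFun (A.CR_transpose k) n) m]; rfl
  rw [hB k m n] at h1
  rw [hB m n k, hB m k n] at h2
  rw [hB n k m] at h3
  rw [s1] at h2
  rw [s2] at h3
  have s3 := hB m k n
  linear_combination h3 - h1 - h2 + s3

/-- The covector y_k is a multiple of Tᵀ t♭ and T M = -R t, so the pairing is a multiple of the skew
form a R evaluated on (t, t). -/
theorem yLowR_dotProduct_MR (i j : Fin N) : A.yLowR ⬝ᵥ A.MR i j = 0 := by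
  have h : A.tLowR ⬝ᵥ (A.RR i j *ᵥ A.tR) = 0 := by
    apply add_self_cancel_of_algebra
    have h1 := congrArg (fun B => A.tR ⬝ᵥ B *ᵥ A.tR) (A.RR_antisymm i j)
    simp only [add_mulVec, dotProduct_add, zero_mulVec, dotProduct_zero, ← mulVec_mulVec] at h1
    rw [dotProduct_mulVec, vecMul_transpose, dotProduct_comm, dotProduct_mulVec A.tR A.aR,
      ← mulVec_transpose, aR_transpose] at h1
    rw [tLowR, h1, add_zero]
  rw [yLowR_eq, smul_dotProduct, mulVec_transpose, ← dotProduct_mulVec, TR_mulVec_MR,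
    dotProduct_neg, h, neg_zero, smul_zero]

theorem rhoR_eq (i j : Fin N) : A.rhoR i j =
    -(A.wR • (vecMulVec (A.MR i j) A.yLowR - vecMulVec A.yR (A.gR *ᵥ A.MR i j)))
      + A.TR⁻¹ * A.RR i j * A.TR := by
  have hE : A.ER i j = (Matrix.of fun n k => ((A.TR⁻¹ * A.TR.map (A.V k)) *ᵥ A.MR i j) n)
      + A.TR⁻¹ * A.RR i j * A.TR := by
    rw [← Matrix.one_mul (A.ER i j), ← inv_mul_TR, Matrix.mul_assoc, Matrix.mul_assoc]
    ext1 n k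
    rw [Matrix.add_apply, mul_apply, mul_apply, of_apply, ← mulVec_mulVec, mulVec, dotProduct,
      ← Finset.sum_add_distrib]
    refine Finset.sum_congr rfl fun h _ => ?_
    rw [TR_mul_ER, mul_add]
    congr 2
    exact Finset.sum_congr rfl fun m _ => congrArg (· * _) (V_comm m k _)
  -- Both sides are compared after lowering the index with the invertible g. Of the three correction
  -- terms, the one containing y_m M^m vanishes.
  have hk : ∀ k, (A.TR⁻¹ * A.TR.map (A.V k)) *ᵥ A.MR i j =
      (A.gR⁻¹ * A.CR k) *ᵥ A.MR i j - A.wR • (A.yLowR k • A.MR i j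
        - (A.gR *ᵥ A.MR i j) k • A.yR) := fun k => by
    have h1 : A.gR * (A.TR⁻¹ * A.TR.map (A.V k)) =
        A.confR • (A.TRᵀ * A.aR * A.TR.map (A.V k)) := by
      rw [gR_eq, smul_mul_assoc, Matrix.mul_assoc, ← Matrix.mul_assoc A.TR, TR_mul_inv,
        Matrix.one_mul]
    have h2 : A.gR *ᵥ ((A.TR⁻¹ * A.TR.map (A.V k)) *ᵥ A.MR i j) = A.gR *ᵥ
        ((A.gR⁻¹ * A.CR k) *ᵥ A.MR i j - A.wR • (A.yLowR k • A.MR i j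
        - (A.gR *ᵥ A.MR i j) k • A.yR)) := by
      rw [mulVec_mulVec, h1, mulVec_sub, mulVec_mulVec, ← Matrix.mul_assoc,
        mul_nonsing_inv _ A.isUnit_det_gR, Matrix.one_mul, mulVec_smul, mulVec_sub, mulVec_smul,
        mulVec_smul, gR_mulVec_yR]
      funext n
      have h0 := A.yLowR_dotProduct_MR i j
      simp only [dotProduct] at h0
      simp only [mulVec, dotProduct, TR_inv_mul_V_TR, Pi.sub_apply, Pi.smul_apply, smul_eq_mul]
      have e : ∀ m, (A.CR k n m - A.wR * (A.yLowR k * A.gR n m + A.yLowR m * A.gR n k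
          - A.yLowR n * A.gR m k)) * A.MR i j m = A.CR k n m * A.MR i j m
          - A.wR * A.yLowR k * (A.gR n m * A.MR i j m)
          - A.wR * A.gR n k * (A.yLowR m * A.MR i j m)
          + A.wR * A.yLowR n * (A.gR k m * A.MR i j m) := fun m => by
        rw [A.gR_symm m k]; ring
      simp only [e, Finset.sum_add_distrib, Finset.sum_sub_distrib, ← Finset.mul_sum, h0]
      ring
    have h3 := congrArg (A.gR⁻¹ *ᵥ ·) h2
    simpa only [mulVec_mulVec, ← Matrix.mul_assoc, nonsing_inv_mul _ A.isUnit_det_gR,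
      Matrix.one_mul, one_mulVec] using h3
  ext1 n k
  have e : A.rhoR i j n k = A.ER i j n k - ((A.gR⁻¹ * A.CR k) *ᵥ A.MR i j) n := by
    rw [rhoR, of_apply, mulVec, dotProduct]
    simp only [mul_comm]
  rw [e, hE, Matrix.add_apply, of_apply, hk]
  simp only [Matrix.add_apply, Matrix.neg_apply, Matrix.smul_apply, Matrix.sub_apply,
    vecMulVec_apply, Pi.sub_apply, Pi.smul_apply, smul_eq_mul]
  ring

/-! ### The Bianchi identities -/

/-- The scalar `(1 - H) / (H S²)`. -/
noncomputable def muR : A.SmoothRing := A.H • (A.wR * A.confR)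

/-- The powers of F cancel, so μ is a constant multiple of 1/S², which d_l annihilates. -/
theorem muR_eq : A.muR = ((1 - A.H) * A.H⁻¹) • Ring.inverse A.sqLen := by
  have h1 : A.FInv ^ 2 * A.FR ^ 2 = 1 := by rw [← mul_pow, mul_comm, FR_mul_FInv, one_pow]
  have h2 : A.H * ((1 - A.H) * A.H⁻¹ ^ 2) = (1 - A.H) * A.H⁻¹ := by
    have := A.H_pos.ne'
    field_simp
  rw [muR, wR, confR, smul_mul_smul_comm, ← mul_assoc, h1, one_mul, smul_smul, h2]

/-- The linear map sending the Riemannian curvature tensor to the Finslerian one, both of them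
in the variable `t`. -/
noncomputable def curvMap (B : Matrix (Fin N) (Fin N) A.SmoothRing) :
    Matrix (Fin N) (Fin N) A.SmoothRing :=
  B + A.muR • (vecMulVec (B *ᵥ A.tR) A.tLowR - vecMulVec A.tR (A.aR *ᵥ (B *ᵥ A.tR)))

theorem curvMap_add (B C : Matrix (Fin N) (Fin N) A.SmoothRing) :
    A.curvMap (B + C) = A.curvMap B + A.curvMap C := by
  simp only [curvMap, add_mulVec, add_vecMulVec, vecMulVec_add, mulVec_add, smul_sub, smul_add]
  abel

theorem curvMap_zero : A.curvMap 0 = 0 := by simp [curvMap]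

theorem curvMap_smul (c : A.SmoothRing) (B : Matrix (Fin N) (Fin N) A.SmoothRing) :
    A.curvMap (c • B) = c • A.curvMap B := by
  simp only [curvMap, smul_mulVec, smul_vecMulVec, vecMulVec_smul, mulVec_smul, smul_sub,
    smul_add, smul_comm c A.muR]

theorem curvMap_neg (B : Matrix (Fin N) (Fin N) A.SmoothRing) :
    A.curvMap (-B) = -A.curvMap B := by
  simp only [curvMap, neg_mulVec, neg_vecMulVec, vecMulVec_neg, mulVec_neg, smul_sub, smul_neg]
  abel

/-- The dictionary between the variables t and y: y = H T⁻¹ t and y_k = H p² (Tᵀ t♭)_k. It is stated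
for arbitrary B so that it also serves the curvature with raised indices. -/
theorem conj_curvMap (B : Matrix (Fin N) (Fin N) A.SmoothRing) :
    A.TR⁻¹ * A.curvMap B * A.TR =
      -(A.wR • (vecMulVec (-((A.TR⁻¹ * B) *ᵥ A.tR)) A.yLowR
        - vecMulVec A.yR (A.gR *ᵥ -((A.TR⁻¹ * B) *ᵥ A.tR)))) + A.TR⁻¹ * B * A.TR := by
  have hy : A.yR = A.H • (A.TR⁻¹ *ᵥ A.tR) := by
    rw [← mulVec_smul, ← TR_mulVec_yR, mulVec_mulVec, inv_mul_TR, one_mulVec]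
  have hg : A.gR *ᵥ -((A.TR⁻¹ * B) *ᵥ A.tR) =
      -(A.confR • (A.TRᵀ *ᵥ (A.aR *ᵥ (B *ᵥ A.tR)))) := by
    rw [gR_eq, smul_mulVec, ← mulVec_mulVec, ← mulVec_mulVec, mulVec_neg, mulVec_mulVec A.tR A.TR,
      ← Matrix.mul_assoc, TR_mul_inv, Matrix.one_mul, mulVec_neg, mulVec_neg, smul_neg]
  rw [hg, hy, yLowR_eq, curvMap, muR]
  simp only [Matrix.mul_add, Matrix.add_mul, mul_smul_comm, smul_mul_assoc, Matrix.mul_sub,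
    Matrix.sub_mul, mul_vecMulVec, vecMulVec_mul, ← mulVec_transpose, ← mulVec_mulVec]
  ext1 n k
  simp only [Matrix.add_apply, Matrix.neg_apply, Matrix.smul_apply, Matrix.sub_apply,
    vecMulVec_apply, Pi.neg_apply, Pi.smul_apply, smul_eq_mul, smul_mul_assoc, mul_smul_comm]
  simp only [Algebra.smul_def]
  ring

theorem rhoR_eq_curvMap (i j : Fin N) :
    A.rhoR i j = A.TR⁻¹ * A.curvMap (A.RR i j) * A.TR := by
  rw [conj_curvMap, ← MR_eq, rhoR_eq]

theorem rhoR_swap (i j : Fin N) : A.rhoR j i = -A.rhoR i j := by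
  rw [rhoR_eq_curvMap, rhoR_eq_curvMap, RR_swap, curvMap_neg, Matrix.mul_neg, Matrix.neg_mul]

theorem MR_swap (i j : Fin N) : A.MR j i = -A.MR i j := by rw [MR, MR, neg_sub]

theorem tLowR_map_dR (l : Fin N) : A.dR l ∘ A.tLowR = A.tLowR ᵥ* A.GR l := by
  rw [tLowR, comp_derivation_mulVec, dR_comp_tR, aR_map_dR, ← mulVec_transpose, add_mulVec,
    mulVec_neg, mulVec_mulVec, mulVec_mulVec]
  abel

/-- Metric compatibility of Γ together with d_l t = -Γ_l t makes the length of t constant along d_l.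
-/
theorem dR_sqLen (l : Fin N) : A.dR l A.sqLen = 0 := by
  have e : A.sqLen = A.tR ⬝ᵥ A.tLowR := rfl
  have h : A.dR l (A.tR ⬝ᵥ A.tLowR) =
      (A.dR l ∘ A.tR) ⬝ᵥ A.tLowR + A.tR ⬝ᵥ (A.dR l ∘ A.tLowR) := by
    simp only [dotProduct, map_sum, Derivation.leibniz, smul_eq_mul, Finset.sum_add_distrib,
      Function.comp_apply]
    rw [add_comm]
    congr 1
    exact Finset.sum_congr rfl fun m _ => mul_comm _ _
  rw [e, h, dR_comp_tR, tLowR_map_dR, neg_dotProduct, dotProduct_comm A.tR, ← dotProduct_mulVec,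
    dotProduct_comm]
  abel

theorem dR_muR (l : Fin N) : A.dR l A.muR = 0 := by
  have h := congrArg (A.dR l) (Ring.mul_inverse_cancel _ A.isUnit_sqLen)
  rw [Derivation.leibniz, dR_sqLen, smul_zero, add_zero, Derivation.map_one_eq_zero,
    smul_eq_mul] at h
  have h0 : A.dR l (Ring.inverse A.sqLen) = 0 := (A.isUnit_sqLen.mul_right_eq_zero).1 h
  rw [muR_eq, Derivation.map_smul, h0, smul_zero]

/-- The covariant derivative of a tensor `B_h^m(x)`. -/
noncomputable def nabla (l : Fin N) (B : Matrix (Fin N) (Fin N) A.SmoothRing) :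
    Matrix (Fin N) (Fin N) A.SmoothRing :=
  B.map (A.dR l) + A.GR l * B - B * A.GR l

theorem nabla_RR (l i j : Fin N) :
    A.nabla l (A.RR i j) + A.nabla j (A.RR l i) + A.nabla i (A.RR j l) = 0 := by
  simp only [nabla, RR_map_dR]
  exact curvMat_bianchi X_comm l i j

/-- Everything that `curvMap` combines with B, namely t, t♭, a and μ, is parallel. -/
theorem nabla_curvMap (l : Fin N) (B : Matrix (Fin N) (Fin N) A.SmoothRing) :
    A.nabla l (A.curvMap B) = A.curvMap (A.nabla l B) := by
  simp only [nabla, curvMap, map_derivation_add, map_derivation_smul, dR_muR, zero_smul,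
    map_derivation_sub, map_derivation_vecMulVec, tLowR_map_dR, comp_derivation_mulVec,
    dR_comp_tR, aR_map_dR, Matrix.mul_add, Matrix.add_mul, mul_smul_comm, smul_mul_assoc,
    Matrix.mul_sub, Matrix.sub_mul, mul_vecMulVec, vecMulVec_mul, ← mulVec_transpose,
    add_mulVec, sub_mulVec, mulVec_add, mulVec_neg, ← mulVec_mulVec, add_vecMulVec,
    vecMulVec_add, neg_vecMulVec, vecMulVec_neg, sub_vecMulVec, vecMulVec_sub, mulVec_sub,
    add_zero, smul_add, smul_sub, smul_neg]
  abel

/-- The terms with D coming from T and T⁻¹ cancel the connection terms on the left, leaving the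
Riemannian derivative in the middle. -/
theorem map_dR_conj (l : Fin N) (B : Matrix (Fin N) (Fin N) A.SmoothRing) :
    (A.TR⁻¹ * B * A.TR).map (A.dR l) + A.DR l * (A.TR⁻¹ * B * A.TR)
      - (A.TR⁻¹ * B * A.TR) * A.DR l = A.TR⁻¹ * A.nabla l B * A.TR := by
  rw [map_derivation_mul, map_derivation_mul, TR_inv_map_dR, TR_map_dR, nabla]
  noncomm_ring

theorem dR_comp_MR (l i j : Fin N) : A.dR l ∘ A.MR i j + A.DR l *ᵥ A.MR i j =
    -((A.TR⁻¹ * A.nabla l (A.RR i j)) *ᵥ A.tR) := by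
  have hn : ∀ v : Fin N → A.SmoothRing, A.dR l ∘ (-v) = -(A.dR l ∘ v) :=
    fun v => funext fun _ => map_neg _ _
  rw [MR_eq, hn, comp_derivation_mulVec, map_derivation_mul, TR_inv_map_dR, dR_comp_tR, nabla]
  simp only [mulVec_neg, mulVec_mulVec, Matrix.mul_add, Matrix.mul_sub, Matrix.sub_mul,
    add_mulVec, sub_mulVec, Matrix.mul_assoc]
  abel

/-- Since Γ is torsion-free, the connection terms acting on the last two, skew indices cancel in
pairs in a cyclic sum. -/
theorem sum_GR_antisymm {W : Type*} [AddCommGroup W] [Module A.SmoothRing W]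
    {B : Fin N → Fin N → W} (hB : ∀ i j, B j i = -B i j) (l i j : Fin N) :
    (∑ s, A.GR i s l • B s j + ∑ s, A.GR j s l • B i s)
    + (∑ s, A.GR l s j • B s i + ∑ s, A.GR i s j • B l s)
    + (∑ s, A.GR j s i • B s l + ∑ s, A.GR l s i • B j s) = 0 := by
  have h : ∀ i j l : Fin N, (∑ s, A.GR i s l • B s j) = -∑ s, A.GR l s i • B j s :=
    fun i j l => by
      rw [← Finset.sum_neg_distrib]
      exact Finset.sum_congr rfl fun s _ => by rw [hB j s, smul_neg, A.GR_symm l s i]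
  rw [h i j l, h l i j, h j l i]
  abel

theorem covM_cyclic {x y : Coord N} (h : (x, y) ∈ A.D) (k n i j : Fin N) :
    A.covM k n i j x y + A.covM j n k i x y + A.covM i n j k x y = 0 := by
  rw [A.rep_covM _ _ _ _ x y h, A.rep_covM _ _ _ _ x y h, A.rep_covM _ _ _ _ x y h, ← map_add,
    ← map_add]
  refine (congrArg (A.ev h) ?_).trans (map_zero _)
  have h1 := A.sum_GR_antisymm (B := fun i j => A.MR i j n)
    (fun i j => congrFun (A.MR_swap i j) n) k i j
  have h2 := congrArg (fun B => ((A.TR⁻¹ * B) *ᵥ A.tR) n) (A.nabla_RR k i j)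
  simp only [Matrix.mul_add, add_mulVec, Pi.add_apply, Matrix.mul_zero, zero_mulVec,
    Pi.zero_apply] at h2
  have e : ∀ k i j, A.dR k (A.MR i j n) + (A.DR k *ᵥ A.MR i j) n =
      -((A.TR⁻¹ * A.nabla k (A.RR i j)) *ᵥ A.tR) n := fun k i j =>
    congrFun (A.dR_comp_MR k i j) n
  rw [e, e, e]
  simp only [smul_eq_mul] at h1
  linear_combination -h1 - h2

theorem covRho_cyclic {x y : Coord N} (h : (x, y) ∈ A.D) (l k n i j : Fin N) :
    A.covRho l k n i j x y + A.covRho j k n l i x y + A.covRho i k n j l x y = 0 := by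
  rw [A.rep_covRho _ _ _ _ _ x y h, A.rep_covRho _ _ _ _ _ x y h, A.rep_covRho _ _ _ _ _ x y h,
    ← map_add, ← map_add]
  refine (congrArg (A.ev h) ?_).trans (map_zero _)
  have h1 := A.sum_GR_antisymm (B := fun i j => A.rhoR i j n k)
    (fun i j => congrFun (congrFun (A.rhoR_swap i j) n) k) l i j
  have h2 := congrArg (fun B => (A.TR⁻¹ * A.curvMap B * A.TR) n k) (A.nabla_RR l i j)
  simp only [Matrix.mul_add, Matrix.add_mul, curvMap_add, curvMap_zero, Matrix.mul_zero,
    Matrix.zero_mul, Matrix.add_apply, Matrix.zero_apply] at h2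
  have e : ∀ l i j, A.dR l (A.rhoR i j n k) + (A.DR l * A.rhoR i j) n k
      - ∑ s, A.DR l s k * A.rhoR i j n s =
      (A.TR⁻¹ * A.curvMap (A.nabla l (A.RR i j)) * A.TR) n k := fun l i j => by
    rw [← nabla_curvMap, ← map_dR_conj, ← rhoR_eq_curvMap]
    simp only [Matrix.sub_apply, Matrix.add_apply, Matrix.map_apply, mul_apply (M := A.rhoR i j),
      mul_comm (A.rhoR i j n _)]
  rw [e, e, e]
  simp only [smul_eq_mul] at h1
  linear_combination h2 - h1

end ConformallyAutomorphicSpace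

theorem Finset.sum_comm_left {ι κ μ M : Type*} [Fintype ι] [Fintype κ] [Fintype μ]
    [AddCommMonoid M] (f : ι → κ → μ → M) :
    ∑ i, ∑ j, ∑ k, f i j k = ∑ k, ∑ i, ∑ j, f i j k :=
  (Finset.sum_congr rfl fun _ _ => Finset.sum_comm).trans Finset.sum_comm

namespace ConformallyAutomorphicSpace

open Matrix

variable {N : ℕ} (A : ConformallyAutomorphicSpace N)

/-! ### Lowering and raising of indices -/

theorem gR_mul_conj (B : Matrix (Fin N) (Fin N) A.SmoothRing) :
    A.gR * (A.TR⁻¹ * B * A.TR) = A.confR • (A.TRᵀ * (A.aR * B) * A.TR) := by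
  rw [gR_eq, smul_mul_assoc, Matrix.mul_assoc _ A.TR, ← Matrix.mul_assoc A.TR,
    ← Matrix.mul_assoc A.TR, TR_mul_inv, Matrix.one_mul]
  simp only [Matrix.mul_assoc]

theorem gR_mulVec_inv (v : Fin N → A.SmoothRing) :
    A.gR *ᵥ (A.TR⁻¹ *ᵥ v) = A.confR • (A.TRᵀ *ᵥ (A.aR *ᵥ v)) := by
  rw [gR_eq, mulVec_mulVec, smul_mul_assoc, Matrix.mul_assoc, TR_mul_inv, Matrix.mul_one,
    smul_mulVec, ← mulVec_mulVec]

/-- Skewness of a tensor `B_h^m` with respect to the metric `a`. -/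
def IsSkew (B : Matrix (Fin N) (Fin N) A.SmoothRing) : Prop := Bᵀ * A.aR = -(A.aR * B)

theorem isSkew_RR (i j : Fin N) : A.IsSkew (A.RR i j) :=
  eq_neg_of_add_eq_zero_left (A.RR_antisymm i j)

theorem dotProduct_aR_mulVec (u v : Fin N → A.SmoothRing) :
    u ⬝ᵥ A.aR *ᵥ v = v ⬝ᵥ A.aR *ᵥ u := by
  rw [dotProduct_mulVec, ← mulVec_transpose, aR_transpose, dotProduct_comm]

variable {A}

theorem IsSkew.dotProduct {B : Matrix (Fin N) (Fin N) A.SmoothRing} (hB : A.IsSkew B)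
    (u v : Fin N → A.SmoothRing) : u ⬝ᵥ A.aR *ᵥ (B *ᵥ v) = -(v ⬝ᵥ A.aR *ᵥ (B *ᵥ u)) := by
  have h : A.aR *ᵥ (B *ᵥ v) = -(Bᵀ *ᵥ (A.aR *ᵥ v)) := by
    rw [mulVec_mulVec, mulVec_mulVec, hB, neg_mulVec, neg_neg]
  rw [h, dotProduct_neg, dotProduct_mulVec, vecMul_transpose, dotProduct_aR_mulVec]

theorem IsSkew.dotProduct_self {B : Matrix (Fin N) (Fin N) A.SmoothRing} (hB : A.IsSkew B)
    (u : Fin N → A.SmoothRing) : u ⬝ᵥ A.aR *ᵥ (B *ᵥ u) = 0 := by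
  apply add_self_cancel_of_algebra
  nth_rewrite 1 [hB.dotProduct u u]
  rw [neg_add_cancel, add_zero]

/-- The correction has the form u ⊗ t♭ - t ⊗ u♭, which is skew for every vector u. -/
theorem IsSkew.curvMap {B : Matrix (Fin N) (Fin N) A.SmoothRing} (hB : A.IsSkew B) :
    A.IsSkew (A.curvMap B) := by
  rw [IsSkew] at hB ⊢
  rw [ConformallyAutomorphicSpace.curvMap, transpose_add, Matrix.add_mul, hB, Matrix.mul_add,
    transpose_smul, transpose_sub, transpose_vecMulVec, transpose_vecMulVec, smul_mul_assoc,
    mul_smul_comm, Matrix.sub_mul, Matrix.mul_sub, vecMulVec_mul, vecMulVec_mul, mul_vecMulVec,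
    mul_vecMulVec, ← mulVec_transpose, ← mulVec_transpose, aR_transpose, ← tLowR, smul_sub,
    smul_sub]
  abel

/-- Up to the factor p², g is the pull-back of a by T, so conjugation by T carries a-skewness to
g-skewness. -/
theorem IsSkew.conj {B : Matrix (Fin N) (Fin N) A.SmoothRing} (hB : A.IsSkew B) :
    (A.TR⁻¹ * B * A.TR)ᵀ * A.gR = -(A.gR * (A.TR⁻¹ * B * A.TR)) := by
  have h : (A.TR⁻¹ * B * A.TR)ᵀ * A.gR = (A.gR * (A.TR⁻¹ * B * A.TR))ᵀ := by
    rw [transpose_mul A.gR, gR_transpose]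
  rw [h, gR_mul_conj, transpose_smul, transpose_mul, transpose_mul, transpose_mul, aR_transpose,
    hB, transpose_transpose, Matrix.neg_mul, Matrix.mul_neg, smul_neg]
  simp only [Matrix.mul_assoc]

/-- By skewness Pt and Qt are orthogonal to t. Each of the two cross terms contributes -2μ ⟨Pt, Qt⟩,
and the product of the corrections contributes -2μ² S² ⟨Pt, Qt⟩. -/
theorem trace_curvMap_mul {P Q : Matrix (Fin N) (Fin N) A.SmoothRing} (hP : A.IsSkew P)
    (hQ : A.IsSkew Q) : trace (A.curvMap P * A.curvMap Q) = trace (P * Q)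
      - (4 * A.muR + 2 * A.muR ^ 2 * A.sqLen) * ((P *ᵥ A.tR) ⬝ᵥ A.aR *ᵥ (Q *ᵥ A.tR)) := by
  have hs : ∀ v, A.tLowR ⬝ᵥ v = A.tR ⬝ᵥ A.aR *ᵥ v := fun v => by
    rw [dotProduct_aR_mulVec, dotProduct_comm]; rfl
  have hs' : ∀ v, v ⬝ᵥ A.tLowR = A.tR ⬝ᵥ A.aR *ᵥ v := fun v => by rw [dotProduct_comm, hs]
  have hv : ∀ u v, (A.aR *ᵥ u) ⬝ᵥ v = u ⬝ᵥ A.aR *ᵥ v := fun u v => by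
    rw [dotProduct_comm, dotProduct_aR_mulVec]
  have hc : ∀ (u v : Fin N → A.SmoothRing) B, u ⬝ᵥ (v ᵥ* B) = v ⬝ᵥ B *ᵥ u := fun u v B => by
    rw [dotProduct_mulVec, dotProduct_comm]
  simp only [ConformallyAutomorphicSpace.curvMap, Matrix.mul_add, Matrix.add_mul, smul_mul_assoc,
    mul_smul_comm, Matrix.mul_sub, Matrix.sub_mul, mul_vecMulVec, vecMulVec_mul,
    trace_add, trace_smul, trace_sub, trace_vecMulVec, hc, hs, hs', hv, add_mulVec, sub_mulVec,
    smul_mulVec, vecMulVec_mulVec, op_smul_eq_smul, mulVec_add, mulVec_sub, mulVec_smul,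
    dotProduct_add, dotProduct_sub, dotProduct_smul, add_dotProduct, sub_dotProduct,
    smul_dotProduct, hP.dotProduct_self A.tR, hQ.dotProduct_self A.tR,
    hP.dotProduct A.tR (Q *ᵥ A.tR), hQ.dotProduct A.tR (P *ᵥ A.tR), smul_eq_mul]
  rw [dotProduct_aR_mulVec A (Q *ᵥ A.tR) (P *ᵥ A.tR), show A.tR ⬝ᵥ A.aR *ᵥ A.tR = A.sqLen from rfl]
  ring

variable (A)

section Raise

variable {W W' : Type*} [AddCommGroup W] [Module A.SmoothRing W] [AddCommGroup W']
  [Module A.SmoothRing W']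

/-- Raising of a pair of indices with the Riemannian metric. -/
noncomputable def raise (B : Fin N → Fin N → W) (i j : Fin N) : W :=
  ∑ m, ∑ r, (A.aR⁻¹ m i * A.aR⁻¹ r j) • B m r

/-- R, M and ρ share the index pair that is raised, and M and ρ are linear in R. Values in a general
module let the formulas for M and ρ pass to their raised versions at once. -/
theorem map_raise (L : W →ₗ[A.SmoothRing] W') (B : Fin N → Fin N → W) (i j : Fin N) :
    L (A.raise B i j) = A.raise (fun m r => L (B m r)) i j := by
  simp only [raise, map_sum, map_smul]

end Raise

theorem raise_apply (B : Fin N → Fin N → Fin N → A.SmoothRing) (i j n : Fin N) :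
    A.raise B i j n = ∑ m, ∑ r, A.aR⁻¹ m i * A.aR⁻¹ r j * B m r n := by
  simp only [raise, Finset.sum_apply, Pi.smul_apply, smul_eq_mul]

theorem raise_apply_apply (B : Fin N → Fin N → Matrix (Fin N) (Fin N) A.SmoothRing)
    (i j n k : Fin N) :
    A.raise B i j n k = ∑ m, ∑ r, A.aR⁻¹ m i * A.aR⁻¹ r j * B m r n k := by
  simp only [raise, Matrix.sum_apply, Matrix.smul_apply, smul_eq_mul]

theorem raise_rhoR (i j : Fin N) :
    A.raise A.rhoR i j = A.TR⁻¹ * A.curvMap (A.raise A.RR i j) * A.TR := by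
  let L : Matrix (Fin N) (Fin N) A.SmoothRing →ₗ[A.SmoothRing] Matrix (Fin N) (Fin N) A.SmoothRing :=
    { toFun := fun B => A.TR⁻¹ * A.curvMap B * A.TR
      map_add' := fun B C => by rw [curvMap_add, Matrix.mul_add, Matrix.add_mul]
      map_smul' := fun c B => by
        rw [curvMap_smul, mul_smul_comm, smul_mul_assoc, RingHom.id_apply] }
  refine Eq.trans ?_ (A.map_raise L A.RR i j).symm
  exact congrArg (fun B => A.raise B i j) (funext fun m => funext fun r => A.rhoR_eq_curvMap m r)

theorem raise_MR (i j : Fin N) :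
    A.raise A.MR i j = -((A.TR⁻¹ * A.raise A.RR i j) *ᵥ A.tR) := by
  let L : Matrix (Fin N) (Fin N) A.SmoothRing →ₗ[A.SmoothRing] (Fin N → A.SmoothRing) :=
    { toFun := fun B => -((A.TR⁻¹ * B) *ᵥ A.tR)
      map_add' := fun B C => by rw [Matrix.mul_add, add_mulVec, neg_add]
      map_smul' := fun c B => by
        rw [mul_smul_comm, smul_mulVec, smul_neg, RingHom.id_apply] }
  refine Eq.trans ?_ (A.map_raise L A.RR i j).symm
  exact congrArg (fun B => A.raise B i j) (funext fun m => funext fun r => A.MR_eq m r)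

theorem isSkew_raise_RR (i j : Fin N) : A.IsSkew (A.raise A.RR i j) := by
  have h : ∀ m r, (A.RR m r)ᵀ * A.aR = -(A.aR * A.RR m r) := A.isSkew_RR
  simp only [IsSkew, raise, transpose_sum, Finset.sum_mul, Finset.mul_sum, transpose_smul,
    smul_mul_assoc, mul_smul_comm, h, smul_neg, Finset.sum_neg_distrib]

theorem rep_MUp (n i j : Fin N) : A.Rep (A.MUp n i j) (A.raise A.MR i j n) := by
  rw [raise_apply]
  exact Rep.sum fun m => Rep.sum fun r =>
    ((A.rep_aInv m i).mul (A.rep_aInv r j)).mul (A.rep_M n m r)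

theorem rep_riemCurvMid (h n i j : Fin N) :
    A.Rep (fun x _ => riemCurvMid A.a h n i j x) (A.raise A.RR i j n h) := by
  rw [raise_apply_apply]
  exact Rep.sum fun m => Rep.sum fun r =>
    ((A.rep_aInv m i).mul (A.rep_aInv r j)).mul (A.rep_riemCurv h n m r)

theorem rep_riemCurvLow (h l i j : Fin N) :
    A.Rep (fun x _ => riemCurvLow A.a h l i j x) ((A.aR * A.RR i j) l h) :=
  Rep.sum fun r => (A.rep_a l r).mul (A.rep_riemCurv h r i j)

theorem aR_inv_symm (m n : Fin N) : A.aR⁻¹ m n = A.aR⁻¹ n m := by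
  have h : (A.aR⁻¹)ᵀ = A.aR⁻¹ := by rw [transpose_nonsing_inv, aR_transpose]
  exact congrFun (congrFun h n) m

theorem rep_riemCurvUp (h r i j : Fin N) :
    A.Rep (fun x _ => riemCurvUp A.a h r i j x) ((A.raise A.RR i j * A.aR⁻¹) r h) := by
  have e : (A.raise A.RR i j * A.aR⁻¹) r h = ∑ l, A.aR⁻¹ h l * A.raise A.RR i j r l := by
    rw [mul_apply]
    exact Finset.sum_congr rfl fun l _ => by rw [A.aR_inv_symm l h, mul_comm]
  rw [e]
  exact Rep.sum fun l => (A.rep_aInv h l).mul (A.rep_riemCurvMid l r i j)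

theorem rep_MLow (n i j : Fin N) : A.Rep (A.MLow n i j) ((A.gR *ᵥ A.MR i j) n) :=
  Rep.sum fun m => (A.rep_g n m).mul (A.rep_M m i j)

theorem rep_rhoLow (k n i j : Fin N) : A.Rep (A.rhoLow k n i j) ((A.gR * A.rhoR i j) n k) := by
  have e : (A.gR * A.rhoR i j) n k = ∑ m, A.gR m n * A.rhoR i j m k := by
    rw [mul_apply]
    exact Finset.sum_congr rfl fun m _ => by rw [A.gR_symm]
  rw [e]
  exact Rep.sum fun m => (A.rep_g m n).mul (A.rep_rho k m i j)

theorem rep_rhoUp (k n i j : Fin N) :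
    A.Rep (A.rhoUp k n i j) ((A.raise A.rhoR i j * A.gR⁻¹) n k) := by
  have e : (A.raise A.rhoR i j * A.gR⁻¹) n k =
      ∑ q, ∑ m, ∑ r, A.gR⁻¹ q k * A.aR⁻¹ m i * A.aR⁻¹ r j * A.rhoR m r n q := by
    rw [mul_apply]
    refine Finset.sum_congr rfl fun q _ => ?_
    rw [raise_apply_apply, Finset.sum_mul]
    refine Finset.sum_congr rfl fun m _ => ?_
    rw [Finset.sum_mul]
    exact Finset.sum_congr rfl fun r _ => by ring
  rw [e]
  exact Rep.sum fun q => Rep.sum fun m => Rep.sum fun r =>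
    (((A.rep_gUp q k).mul (A.rep_aInv m i)).mul (A.rep_aInv r j)).mul (A.rep_rho q n m r)

theorem rep_Q : A.Rep A.Q
    (∑ i, ∑ j, (A.raise A.RR i j *ᵥ A.tR) ⬝ᵥ A.aR *ᵥ (A.RR i j *ᵥ A.tR)) := by
  have e : ∑ i, ∑ j, (A.raise A.RR i j *ᵥ A.tR) ⬝ᵥ A.aR *ᵥ (A.RR i j *ᵥ A.tR) =
      ∑ l, ∑ h, ∑ n, ∑ i, ∑ j, A.tR l * A.raise A.RR i j n l *
        (A.tR h * (A.aR * A.RR i j) n h) := by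
    have e1 : ∀ i j, (A.raise A.RR i j *ᵥ A.tR) ⬝ᵥ A.aR *ᵥ (A.RR i j *ᵥ A.tR) =
        ∑ l, ∑ h, ∑ n, A.tR l * A.raise A.RR i j n l * (A.tR h * (A.aR * A.RR i j) n h) :=
      fun i j => by
        rw [mulVec_mulVec, Finset.sum_comm_left]
        simp only [mulVec, dotProduct, Finset.sum_mul_sum]
        exact Finset.sum_congr rfl fun n _ => Finset.sum_congr rfl fun l _ =>
          Finset.sum_congr rfl fun h _ => by ring
    simp only [e1]
    rw [Finset.sum_comm_left]
    refine Finset.sum_congr rfl fun l _ => ?_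
    rw [Finset.sum_comm_left]
    exact Finset.sum_congr rfl fun h _ => Finset.sum_comm_left _
  rw [e]
  exact Rep.sum fun l => Rep.sum fun h => Rep.sum fun n => Rep.sum fun i => Rep.sum fun j =>
    ((A.rep_t l).mul (A.rep_riemCurvMid l n i j)).mul
      ((A.rep_t h).mul (A.rep_riemCurvLow h n i j))

end ConformallyAutomorphicSpace

open Matrix in
-- The contraction is the trace of (B g⁻¹)ᵀ g C; skewness of B moves g past Bᵀ at the cost of a
-- sign.
theorem Matrix.sum_raised_mul_lowered {R n : Type*} [CommRing R] [Fintype n] [DecidableEq n]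
    {g : Matrix n n R} (hg : gᵀ = g) (hu : IsUnit g.det) {B : Matrix n n R}
    (hB : Bᵀ * g = -(g * B)) (C : Matrix n n R) :
    ∑ k, ∑ m, (B * g⁻¹) m k * (g * C) m k = -trace (B * C) := by
  have h : ∑ k, ∑ m, (B * g⁻¹) m k * (g * C) m k = trace ((B * g⁻¹)ᵀ * (g * C)) := by
    simp only [trace, diag_apply, mul_apply (M := (B * g⁻¹)ᵀ), transpose_apply]
  rw [h, transpose_mul, transpose_nonsing_inv, hg, Matrix.mul_assoc, ← Matrix.mul_assoc Bᵀ, hB,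
    Matrix.neg_mul, Matrix.mul_neg, Matrix.mul_assoc, ← Matrix.mul_assoc g⁻¹,
    nonsing_inv_mul _ hu, Matrix.one_mul, trace_neg]

namespace ConformallyAutomorphicSpace

open Matrix

variable {N : ℕ} (A : ConformallyAutomorphicSpace N)

/-! ### The curvature identities in components -/

variable {A} in
theorem Rep.eq {f g : Coord N → Coord N → ℝ} {φ ψ : A.SmoothRing} (hf : A.Rep f φ)
    (hg : A.Rep g ψ) (e : φ = ψ) {x y : Coord N} (h : (x, y) ∈ A.D) : f x y = g x y := by
  rw [hf x y h, hg x y h, e]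

theorem rep_const (r : ℝ) : A.Rep (fun _ _ => r) (algebraMap ℝ A.SmoothRing r) :=
  fun _ _ h => ((A.ev h).commutes r).symm

theorem rep_lLow (k : Fin N) : A.Rep (A.lLow k) (A.yLowR k * A.FInv) := fun x y h => by
  rw [lLow, div_eq_mul_one_div]
  exact (A.rep_covector k).mul A.rep_FInv x y h

theorem rep_lUp (k : Fin N) : A.Rep (A.lUp k) (A.yR k * A.FInv) := fun x y h => by
  rw [lUp, div_eq_mul_one_div]
  exact (A.rep_y k).mul A.rep_FInv x y h

variable {A} in
theorem Rep.inverse {f : Coord N → Coord N → ℝ} {φ : A.SmoothRing} (hf : A.Rep f φ)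
    (hu : IsUnit φ) : A.Rep (fun x y => 1 / f x y) (Ring.inverse φ) := fun x y h => by
  have e := congrArg (A.ev h) (Ring.mul_inverse_cancel _ hu)
  rw [map_mul, map_one, ← hf x y h] at e
  beta_reduce
  rw [one_div, inv_eq_of_mul_eq_one_right e]

theorem isUnit_confR : IsUnit A.confR := isUnit_of_ev_ne_zero fun x y h => by
  rw [← A.rep_confR x y h]
  have hF := A.F_pos x y h
  have hH := A.H_pos
  exact (pow_pos (mul_pos (one_div_pos.2 hH) (Real.rpow_pos_of_pos hF _)) 2).ne'

theorem rep_riemNorm_sq : A.Rep (fun x y => riemNorm A.a x (A.t x y) ^ 2) A.sqLen :=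
  fun x y h => by rw [ev_sqLen]; exact A.riemNorm_sq h

variable {x y : Coord N} (hxy : (x, y) ∈ A.D)
include hxy

theorem M_eq (n i j : Fin N) : A.M n i j x y =
    -∑ s, ∑ h, A.yD n s x y * A.t x y h * riemCurv A.a h s i j x := by
  refine (A.rep_M n i j).eq (Rep.neg (Rep.sum fun s => Rep.sum fun h =>
    ((A.rep_yD n s).mul (A.rep_t h)).mul (A.rep_riemCurv h s i j))) ?_ hxy
  rw [MR_eq, ← mulVec_mulVec]
  simp only [Pi.neg_apply, mulVec, dotProduct, Finset.mul_sum]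
  exact congrArg _ (Finset.sum_congr rfl fun s _ => Finset.sum_congr rfl fun h _ => by ring)

theorem E_eq (k n i j : Fin N) : A.E k n i j x y =
    ∑ h, ∑ m, A.yD n h x y * A.tDD h k m x y * A.M m i j x y
      + ∑ m, ∑ h, A.yD n m x y * riemCurv A.a h m i j x * A.tD h k x y := by
  refine (A.rep_E k n i j).eq (Rep.add
    (Rep.sum fun h => Rep.sum fun m =>
      ((A.rep_yD n h).mul (A.rep_tDD h k m)).mul (A.rep_M m i j))
    (Rep.sum fun m => Rep.sum fun h =>
      ((A.rep_yD n m).mul (A.rep_riemCurv h m i j)).mul (A.rep_tD h k))) ?_ hxy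
  rw [← Matrix.one_mul (A.ER i j), ← inv_mul_TR, Matrix.mul_assoc, mul_apply]
  simp only [TR_mul_ER]
  simp only [mul_apply, mul_add, Finset.sum_add_distrib, Finset.mul_sum, mul_assoc]

theorem rho_eq (k n i j : Fin N) : A.rho k n i j x y =
    -(1 - A.H) * (1 / A.F x y) *
        ∑ m, (A.lLow k x y * (if n = m then 1 else 0) - A.lUp n x y * A.g m k x y)
          * A.M m i j x y
      + ∑ m, ∑ h, A.yD n m x y * riemCurv A.a h m i j x * A.tD h k x y := by
  have hδ : ∀ m, A.Rep (fun _ _ => if n = m then 1 else 0) (if n = m then 1 else 0) :=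
    fun m _ _ h => by split_ifs <;> simp
  refine (A.rep_rho k n i j).eq (Rep.add
    (Rep.mul (Rep.const_mul (-(1 - A.H)) A.rep_FInv) (Rep.sum fun m =>
      (((A.rep_lLow k).mul (hδ m)).sub ((A.rep_lUp n).mul (A.rep_g m k))).mul (A.rep_M m i j)))
    (Rep.sum fun m => Rep.sum fun h =>
      ((A.rep_yD n m).mul (A.rep_riemCurv h m i j)).mul (A.rep_tD h k))) ?_ hxy
  have e1 : ∑ m, (A.yLowR k * A.FInv * (if n = m then 1 else 0)
      - A.yR n * A.FInv * A.gR m k) * A.MR i j m =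
      A.FInv * (A.MR i j n * A.yLowR k - A.yR n * (A.gR *ᵥ A.MR i j) k) := by
    simp only [sub_mul, Finset.sum_sub_distrib, mul_ite, ite_mul, mul_one, mul_zero, zero_mul,
      Finset.sum_ite_eq, Finset.mem_univ, if_true, mulVec, dotProduct, mul_sub, Finset.mul_sum]
    congr 1
    · ring
    · exact Finset.sum_congr rfl fun m _ => by rw [A.gR_symm]; ring
  have e2 : (A.TR⁻¹ * A.RR i j * A.TR) n k =
      ∑ m, ∑ h, A.TR⁻¹ n m * A.RR i j m h * A.TR h k := by
    rw [Matrix.mul_assoc]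
    simp only [mul_apply, Finset.mul_sum, mul_assoc]
  rw [e1, rhoR_eq, Matrix.add_apply, e2]
  congr 1
  simp only [Matrix.neg_apply, Matrix.smul_apply, Matrix.sub_apply, vecMulVec_apply, wR,
    smul_eq_mul]
  simp only [Algebra.smul_def, map_neg]
  ring

theorem rhoLow_eq (k n i j : Fin N) : A.rhoLow k n i j x y =
    -(1 - A.H) * (1 / A.F x y) *
        (A.lLow k x y * A.MLow n i j x y - A.lLow n x y * A.MLow k i j x y)
      + A.p x y ^ 2 * ∑ h, ∑ l, riemCurvLow A.a h l i j x * A.tD h k x y * A.tD l n x y := by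
  refine (A.rep_rhoLow k n i j).eq (Rep.add
    (Rep.mul (Rep.const_mul (-(1 - A.H)) A.rep_FInv)
      (((A.rep_lLow k).mul (A.rep_MLow n i j)).sub ((A.rep_lLow n).mul (A.rep_MLow k i j))))
    (A.rep_confR.mul (Rep.sum fun h => Rep.sum fun l =>
      ((A.rep_riemCurvLow h l i j).mul (A.rep_tD h k)).mul (A.rep_tD l n)))) ?_ hxy
  have e : (A.TRᵀ * (A.aR * A.RR i j) * A.TR) n k =
      ∑ h, ∑ l, (A.aR * A.RR i j) l h * A.TR h k * A.TR l n := by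
    rw [congruence_apply, Finset.sum_comm]
    exact Finset.sum_congr rfl fun h _ => Finset.sum_congr rfl fun l _ => by ring
  rw [rhoR_eq, Matrix.mul_add, gR_mul_conj, Matrix.mul_neg, mul_smul_comm, Matrix.mul_sub,
    mul_vecMulVec, mul_vecMulVec, gR_mulVec_yR, Matrix.add_apply, Matrix.smul_apply, e, smul_eq_mul]
  congr 1
  simp only [Matrix.neg_apply, Matrix.smul_apply, Matrix.sub_apply, vecMulVec_apply, wR,
    smul_eq_mul]
  simp only [Algebra.smul_def, map_neg]
  ring

theorem rhoUp_eq (k n i j : Fin N) : A.rhoUp k n i j x y =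
    -(1 - A.H) * (1 / A.F x y) *
        (A.lUp k x y * A.MUp n i j x y - A.lUp n x y * A.MUp k i j x y)
      + 1 / A.p x y ^ 2 *
        ∑ h, ∑ r, A.yD k h x y * A.yD n r x y * riemCurvUp A.a h r i j x := by
  refine (A.rep_rhoUp k n i j).eq (Rep.add
    (Rep.mul (Rep.const_mul (-(1 - A.H)) A.rep_FInv)
      (((A.rep_lUp k).mul (A.rep_MUp n i j)).sub ((A.rep_lUp n).mul (A.rep_MUp k i j))))
    ((A.rep_confR.inverse A.isUnit_confR).mul (Rep.sum fun h => Rep.sum fun r =>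
      ((A.rep_yD k h).mul (A.rep_yD n r)).mul (A.rep_riemCurvUp h r i j)))) ?_ hxy
  have hinv : A.gR⁻¹ = Ring.inverse A.confR • (A.TR⁻¹ * A.aR⁻¹ * A.TR⁻¹ᵀ) := by
    refine inv_eq_right_inv ?_
    rw [gR_eq, smul_mul_smul_comm, Ring.mul_inverse_cancel _ A.isUnit_confR, one_smul]
    have h1 : A.TRᵀ * A.TR⁻¹ᵀ = 1 := by rw [← transpose_mul, inv_mul_TR, transpose_one]
    calc A.TRᵀ * A.aR * A.TR * (A.TR⁻¹ * A.aR⁻¹ * A.TR⁻¹ᵀ)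
        = A.TRᵀ * A.aR * (A.TR * A.TR⁻¹) * A.aR⁻¹ * A.TR⁻¹ᵀ := by simp only [Matrix.mul_assoc]
      _ = A.TRᵀ * (A.aR * A.aR⁻¹) * A.TR⁻¹ᵀ := by
        rw [TR_mul_inv, Matrix.mul_one, Matrix.mul_assoc A.TRᵀ]
      _ = 1 := by rw [mul_nonsing_inv _ A.isUnit_det_aR, Matrix.mul_one, h1]
  have hgi : (A.gR⁻¹)ᵀ = A.gR⁻¹ := by rw [transpose_nonsing_inv, gR_transpose]
  have hy : A.yLowR ᵥ* A.gR⁻¹ = A.yR := by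
    rw [← mulVec_transpose, hgi, ← gR_mulVec_yR, mulVec_mulVec,
      nonsing_inv_mul _ A.isUnit_det_gR, one_mulVec]
  have hm : (A.gR *ᵥ A.raise A.MR i j) ᵥ* A.gR⁻¹ = A.raise A.MR i j := by
    rw [← mulVec_transpose, hgi, mulVec_mulVec, nonsing_inv_mul _ A.isUnit_det_gR, one_mulVec]
  have e : (A.TR⁻¹ * A.raise A.RR i j * A.TR) * A.gR⁻¹ = Ring.inverse A.confR •
      (A.TR⁻¹ * ((A.raise A.RR i j * A.aR⁻¹) * A.TR⁻¹ᵀ)) := by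
    rw [hinv, mul_smul_comm]
    congr 1
    calc A.TR⁻¹ * A.raise A.RR i j * A.TR * (A.TR⁻¹ * A.aR⁻¹ * A.TR⁻¹ᵀ)
        = A.TR⁻¹ * A.raise A.RR i j * (A.TR * A.TR⁻¹) * A.aR⁻¹ * A.TR⁻¹ᵀ := by
          simp only [Matrix.mul_assoc]
      _ = _ := by rw [TR_mul_inv]; simp only [Matrix.mul_assoc, Matrix.one_mul]
  have e2 : (A.TR⁻¹ * ((A.raise A.RR i j * A.aR⁻¹) * A.TR⁻¹ᵀ)) n k =
      ∑ h, ∑ r, A.TR⁻¹ k h * A.TR⁻¹ n r * (A.raise A.RR i j * A.aR⁻¹) r h := by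
    rw [Finset.sum_comm]
    simp only [mul_apply (M := A.TR⁻¹), mul_apply (N := A.TR⁻¹ᵀ), transpose_apply, Finset.mul_sum]
    exact Finset.sum_congr rfl fun h _ => Finset.sum_congr rfl fun l _ => by ring
  rw [raise_rhoR, conj_curvMap, ← raise_MR, Matrix.add_mul, Matrix.neg_mul, smul_mul_assoc,
    Matrix.sub_mul, vecMulVec_mul, vecMulVec_mul, hy, hm, e, Matrix.add_apply, Matrix.smul_apply,
    e2, smul_eq_mul]
  congr 1
  simp only [Matrix.neg_apply, Matrix.smul_apply, Matrix.sub_apply, vecMulVec_apply, wR,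
    smul_eq_mul]
  simp only [Algebra.smul_def, map_neg]
  ring

theorem MLow_eq (n i j : Fin N) : A.MLow n i j x y =
    -A.p x y ^ 2 * ∑ h, ∑ m, A.t x y h * A.tD m n x y * riemCurvLow A.a h m i j x := by
  refine (A.rep_MLow n i j).eq (Rep.mul A.rep_confR.neg (Rep.sum fun h => Rep.sum fun m =>
    ((A.rep_t h).mul (A.rep_tD m n)).mul (A.rep_riemCurvLow h m i j))) ?_ hxy
  rw [MR_eq, ← mulVec_mulVec, mulVec_neg, gR_mulVec_inv, mulVec_mulVec A.tR, Finset.sum_comm]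
  simp only [Pi.neg_apply, Pi.smul_apply, smul_eq_mul, mulVec, dotProduct, transpose_apply,
    Finset.mul_sum, neg_mul, Finset.sum_neg_distrib]
  exact congrArg _ (Finset.sum_congr rfl fun s _ => Finset.sum_congr rfl fun h _ => by ring)

theorem sum_MUp_mul_MLow :
    ∑ n, ∑ i, ∑ j, A.MUp n i j x y * A.MLow n i j x y = A.p x y ^ 2 * A.Q x y := by
  refine (Rep.sum fun n => Rep.sum fun i => Rep.sum fun j =>
    (A.rep_MUp n i j).mul (A.rep_MLow n i j)).eq (A.rep_confR.mul A.rep_Q) ?_ hxy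
  rw [← Finset.sum_comm_left fun i j n => A.raise A.MR i j n * (A.gR *ᵥ A.MR i j) n]
  simp only [Finset.mul_sum]
  refine Finset.sum_congr rfl fun i _ => Finset.sum_congr rfl fun j _ => ?_
  change A.raise A.MR i j ⬝ᵥ (A.gR *ᵥ A.MR i j) = _
  rw [raise_MR, MR_eq, ← mulVec_mulVec, ← mulVec_mulVec, mulVec_neg, gR_mulVec_inv,
    neg_dotProduct_neg, dotProduct_smul, mulVec_transpose, dotProduct_comm, ← dotProduct_mulVec,
    mulVec_mulVec _ A.TR, TR_mul_inv, one_mulVec, dotProduct_comm, smul_eq_mul]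

theorem rhoLow_antisymm (m n i j : Fin N) : A.rhoLow m n i j x y = -A.rhoLow n m i j x y := by
  refine (A.rep_rhoLow m n i j).eq (A.rep_rhoLow n m i j).neg ?_ hxy
  have h := congrFun (congrFun (A.isSkew_RR i j).curvMap.conj m) n
  rw [← rhoR_eq_curvMap] at h
  have h1 : (A.rhoR i j)ᵀ * A.gR = (A.gR * A.rhoR i j)ᵀ := by rw [transpose_mul, gR_transpose]
  rw [h1] at h
  exact h

theorem sum_rhoUp_mul_rhoLow :
    ∑ k, ∑ n, ∑ i, ∑ j, A.rhoUp k n i j x y * A.rhoLow k n i j x y =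
      ∑ k, ∑ n, ∑ i, ∑ j, riemCurvUp A.a k n i j x * riemCurvLow A.a k n i j x
        + 2 / riemNorm A.a x (A.t x y) ^ 2 * ((A.H ^ 2)⁻¹ - 1) * A.Q x y := by
  rw [div_eq_mul_one_div]
  refine (Rep.sum fun k => Rep.sum fun n => Rep.sum fun i => Rep.sum fun j =>
    (A.rep_rhoUp k n i j).mul (A.rep_rhoLow k n i j)).eq (Rep.add
    (Rep.sum fun k => Rep.sum fun n => Rep.sum fun i => Rep.sum fun j =>
      (A.rep_riemCurvUp k n i j).mul (A.rep_riemCurvLow k n i j))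
    ((((A.rep_riemNorm_sq.inverse A.isUnit_sqLen).const_mul 2).mul
      (A.rep_const ((A.H ^ 2)⁻¹ - 1))).mul A.rep_Q)) ?_ hxy
  -- With i and j outermost, each inner double sum becomes a matrix trace.
  have hc : ∀ f : Fin N → Fin N → Fin N → Fin N → A.SmoothRing,
      ∑ k, ∑ n, ∑ i, ∑ j, f k n i j = ∑ i, ∑ j, ∑ k, ∑ n, f k n i j := fun f => by
    rw [Finset.sum_comm_left]
    exact Finset.sum_congr rfl fun i _ => Finset.sum_comm_left _
  refine (hc _).trans ?_
  rw [hc fun k n i j => (A.raise A.RR i j * A.aR⁻¹) n k * (A.aR * A.RR i j) n k, Finset.mul_sum, ← Finset.sum_add_distrib]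
  refine Finset.sum_congr rfl fun i _ => ?_
  rw [Finset.mul_sum, ← Finset.sum_add_distrib]
  refine Finset.sum_congr rfl fun j _ => ?_
  have hP := A.isSkew_raise_RR i j
  have hQ := A.isSkew_RR i j
  rw [sum_raised_mul_lowered A.aR_transpose A.isUnit_det_aR hP,
    sum_raised_mul_lowered A.gR_transpose A.isUnit_det_gR
      (by rw [raise_rhoR]; exact hP.curvMap.conj)]
  -- The conjugation by T disappears from the trace of a product.
  have ht : trace (A.raise A.rhoR i j * A.rhoR i j) =
      trace (A.curvMap (A.raise A.RR i j) * A.curvMap (A.RR i j)) := by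
    rw [raise_rhoR, rhoR_eq_curvMap]
    set P := A.curvMap (A.raise A.RR i j)
    set Q := A.curvMap (A.RR i j)
    calc trace (A.TR⁻¹ * P * A.TR * (A.TR⁻¹ * Q * A.TR))
        = trace (A.TR⁻¹ * (P * (A.TR * A.TR⁻¹) * Q * A.TR)) := by simp only [Matrix.mul_assoc]
      _ = trace (P * Q) := by
        rw [TR_mul_inv, Matrix.mul_one, trace_mul_comm, Matrix.mul_assoc, TR_mul_inv,
          Matrix.mul_one]
  rw [ht, trace_curvMap_mul hP hQ]
  have hμ : 4 * A.muR + 2 * A.muR ^ 2 * A.sqLen =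
      ((2 : ℝ) • Ring.inverse A.sqLen) * algebraMap ℝ A.SmoothRing ((A.H ^ 2)⁻¹ - 1) := by
    have hs := Ring.mul_inverse_cancel _ A.isUnit_sqLen
    have hH := A.H_pos.ne'
    -- With κ = (1-H)/H one has 1 + κ = 1/H, and 4κ + 2κ² = 2((1 + κ)² - 1).
    have hκ : 4 * ((1 - A.H) * A.H⁻¹) + 2 * ((1 - A.H) * A.H⁻¹) ^ 2 = 2 * ((A.H ^ 2)⁻¹ - 1) := by
      field_simp
      ring
    rw [muR_eq]
    generalize (1 - A.H) * A.H⁻¹ = κ at hκ ⊢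
    generalize (A.H ^ 2)⁻¹ - 1 = ν at hκ ⊢
    have hκ' := congrArg (algebraMap ℝ A.SmoothRing) hκ
    rw [Algebra.smul_def, Algebra.smul_def]
    simp only [map_add, map_mul, map_pow, map_ofNat] at hκ' ⊢
    set s := Ring.inverse A.sqLen
    linear_combination s * hκ' + 2 * (algebraMap ℝ A.SmoothRing κ) ^ 2 * s * hs
  rw [← hμ]
  ring

end ConformallyAutomorphicSpace

theorem mainTheorem6 {N : ℕ} (hN : 3 ≤ N) (A : ConformallyAutomorphicSpace N)
    (x y : Coord N) (hxy : (x, y) ∈ A.D) :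
    (∀ n i j, A.M n i j x y =
      -∑ s, ∑ h, A.yD n s x y * A.t x y h * riemCurv A.a h s i j x) ∧
    (∀ k n i j, A.E k n i j x y =
      ∑ h, ∑ m, A.yD n h x y * A.tDD h k m x y * A.M m i j x y
        + ∑ m, ∑ h, A.yD n m x y * riemCurv A.a h m i j x * A.tD h k x y) ∧
    (∀ k n i j, A.rhoLow k n i j x y =
      -(1 - A.H) * (1 / A.F x y) *
          (A.lLow k x y * A.MLow n i j x y - A.lLow n x y * A.MLow k i j x y)
        + A.p x y ^ 2 * ∑ h, ∑ l, riemCurvLow A.a h l i j x * A.tD h k x y * A.tD l n x y) ∧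
    (∀ k n i j, A.rho k n i j x y =
      -(1 - A.H) * (1 / A.F x y) *
          ∑ m, (A.lLow k x y * (if n = m then 1 else 0) - A.lUp n x y * A.g m k x y)
            * A.M m i j x y
        + ∑ m, ∑ h, A.yD n m x y * riemCurv A.a h m i j x * A.tD h k x y) ∧
    (∀ k n i j, A.rhoUp k n i j x y =
      -(1 - A.H) * (1 / A.F x y) *
          (A.lUp k x y * A.MUp n i j x y - A.lUp n x y * A.MUp k i j x y)
        + 1 / A.p x y ^ 2 *
          ∑ h, ∑ r, A.yD k h x y * A.yD n r x y * riemCurvUp A.a h r i j x) ∧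
    (∀ n i j, A.MLow n i j x y =
      -A.p x y ^ 2 * ∑ h, ∑ m, A.t x y h * A.tD m n x y * riemCurvLow A.a h m i j x) ∧
    (∑ n, ∑ i, ∑ j, A.MUp n i j x y * A.MLow n i j x y = A.p x y ^ 2 * A.Q x y) ∧
    (∀ m n i j, A.rhoLow m n i j x y = -A.rhoLow n m i j x y) ∧
    (∀ k n i j, A.covM k n i j x y + A.covM j n k i x y + A.covM i n j k x y = 0) ∧
    (∀ l k n i j,
      A.covRho l k n i j x y + A.covRho j k n l i x y + A.covRho i k n j l x y = 0) ∧
    (∑ k, ∑ n, ∑ i, ∑ j, A.rhoUp k n i j x y * A.rhoLow k n i j x y =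
      ∑ k, ∑ n, ∑ i, ∑ j, riemCurvUp A.a k n i j x * riemCurvLow A.a k n i j x
        + 2 / riemNorm A.a x (A.t x y) ^ 2 * ((A.H ^ 2)⁻¹ - 1) * A.Q x y) :=
  ⟨A.M_eq hxy, A.E_eq hxy, A.rhoLow_eq hxy, A.rho_eq hxy, A.rhoUp_eq hxy, A.MLow_eq hxy,
    A.sum_MUp_mul_MLow hxy, A.rhoLow_antisymm hxy, A.covM_cyclic hxy, A.covRho_cyclic hxy,
    A.sum_rhoUp_mul_rhoLow hxy⟩
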